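/- **Theorem 4.1 and Corollary 4.2 (genus of nonsingular arrangement curves).** Let $K$ be a field of characteristic zero (for example a number field), $a\in K$, $N\ge 1$, and $f_c(x)=x^2+c$. An *arrangement of $2N$ iterated pre-images of $a$* prescribes, for $N$ pairs $\pm z_1,\dots,\pm z_N$, the common images $$f_c(z_1)=a,\qquad f_c(z_i)=\epsilon_i z_{j(i)}\quad(2\le i\le N),$$ where $1\le j(i)<i$ and $\epsilon_i\in\{1,-1\}$, and where distinct $i$ have distinct $(j(i),\epsilon_i)$. Eliminating $c$ from these equations in $(z_1,\dots,z_N,c)$ and homogenizing gives a curve $C_a\subset\mathbb{P}^N_K$ (the fiber over $a$). Its homogeneous ideal is generated by the forms $F(Z_0,\dots,Z_N)$ for which $F(1,z_1,\dots,z_N)$ lies in the ideal of $K[z_1,\dots,z_N,c]$ generated by the equations $z_1^2+c-a$ and $z_i^2+c-\epsilon_i z_{j(i)}$ for $2\le i\le N$. Suppose that $C_a$ is nonsingular: at every point of $C_a(\overline K)$ the Jacobian matrix of its equations has rank $N-1$. Then: 1. $C_a$ is a complete intersection of $N-1$ quadrics in $\mathbb{P}^N$: its homogeneous ideal is generated by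 $N-1$ forms of degree two, and its codimension is $N-1$. 2. $C_a$ is integral, and its geometric genus, that is, the (finite) dimension over $K$ of the space of everywhere regular differentials on $C_a$, is $$g(C_a)=(N-3)\,2^{N-2}+1 .$$ 3. If $2N\ge 8$, then $g(C_a)>1$. -/

import Mathlib

open scoped KaehlerDifferential

noncomputable section

/-- A (combinatorial) arrangement of `2N` iterated pre-images `± z_i`, `i : Fin N`, of a point `a`
under `f_c(x) = x ^ 2 + c`.  The common image of `z_i` and `-z_i` is `a` if `target i = none`, and
`ε z_j` if `target i = some (j, ε)`.  Different pairs `± z_i` have different images, and the pairs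
are numbered so that an image is listed before its pre-images.  (Thus exactly the pair numbered `0`
is mapped to `a`.) -/
structure PreimageArrangement (N : ℕ) where
  target : Fin N → Option (Fin N × ℤˣ)
  target_injective : Function.Injective target
  target_lt : ∀ (i j : Fin N) (ε : ℤˣ), target i = some (j, ε) → j < i

namespace PreimageArrangement

variable {K : Type*} [Field K] {N : ℕ}

/-- The polynomial ring in the unknowns `z_i = X (some i)` and `c = X none`; the value
`f_c(z_i)` that the arrangement prescribes, which is `a` or `± z_j`. -/
def image (T : PreimageArrangement N) (a : K) (i : Fin N) : MvPolynomial (Option (Fin N)) K :=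
  match T.target i with
  | none => MvPolynomial.C a
  | some (j, ε) => ((ε : ℤ) : MvPolynomial (Option (Fin N)) K) * MvPolynomial.X (some j)

/-- The ideal of the affine curve of all `(z, c)` that realize the arrangement: the equations are
`z_i ^ 2 + c = f_c(z_i) = a` or `± z_j`. -/
def affineIdeal (T : PreimageArrangement N) (a : K) :
    Ideal (MvPolynomial (Option (Fin N)) K) :=
  Ideal.span (Set.range fun i : Fin N =>
    MvPolynomial.X (some i) ^ 2 + MvPolynomial.X none - T.image a i)

/-- The homogeneous ideal in `K[Z_0, …, Z_N]` of the fiber curve in `ℙ^N`, the curve obtained from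
the affine curve by eliminating `c` and homogenizing: it is generated by the forms `F` such that
`F(1, z_1, …, z_N)` lies in the ideal of the affine curve. -/
def fiberIdeal (T : PreimageArrangement N) (a : K) : Ideal (MvPolynomial (Fin (N + 1)) K) :=
  Ideal.span {F | (∃ d : ℕ, F.IsHomogeneous d) ∧
    MvPolynomial.aeval
      (Fin.cons 1 (fun i : Fin N => MvPolynomial.X (some i)) :
        Fin (N + 1) → MvPolynomial (Option (Fin N)) K) F ∈ T.affineIdeal a}

end PreimageArrangement

/-- The gradient of a polynomial at a geometric point. -/
def gradientAt {K : Type*} [Field K] {σ : Type*} (P : σ → AlgebraicClosure K)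
    (F : MvPolynomial σ K) : σ → AlgebraicClosure K :=
  fun i => MvPolynomial.aeval P (MvPolynomial.pderiv i F)

/-- Nonsingularity of the projective curve in `ℙ^m` with homogeneous ideal `I`, by the Jacobian
criterion: at every geometric point, the Jacobian matrix of the equations has rank `m - 1`. -/
def IsNonsingularProjectiveCurve {K : Type*} [Field K] {m : ℕ}
    (I : Ideal (MvPolynomial (Fin (m + 1)) K)) : Prop :=
  ∀ P : Fin (m + 1) → AlgebraicClosure K, P ≠ 0 → (∀ F ∈ I, MvPolynomial.aeval P F = 0) →
    Module.finrank (AlgebraicClosure K)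
      (Submodule.span (AlgebraicClosure K) (gradientAt P '' (I : Set _))) + 1 = m

/-- The subscheme of `ℙ^m` with homogeneous ideal `I` is a complete intersection of `r` quadrics:
`I` is generated by `r` quadratic forms, where `r` is the codimension of the subscheme. -/
def IsCompleteIntersectionOfQuadrics {K : Type*} [Field K] {m : ℕ}
    (I : Ideal (MvPolynomial (Fin (m + 1)) K)) (r : ℕ) : Prop :=
  ∃ Q : Fin r → MvPolynomial (Fin (m + 1)) K,
    (∀ i, (Q i).IsHomogeneous 2) ∧ I = Ideal.span (Set.range Q) ∧ I.height = r

/-- The function field of the integral projective variety with homogeneous prime ideal `I`: the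
field of the quotients `f / g` of forms of the same degree on the variety. -/
def projectiveFunctionField {K : Type*} [Field K] {m : ℕ}
    (I : Ideal (MvPolynomial (Fin (m + 1)) K)) [I.IsPrime] :
    IntermediateField K (FractionRing (MvPolynomial (Fin (m + 1)) K ⧸ I)) :=
  IntermediateField.adjoin K {x | ∃ (d : ℕ) (f g : MvPolynomial (Fin (m + 1)) K),
    f.IsHomogeneous d ∧ g.IsHomogeneous d ∧ g ∉ I ∧
      x = algebraMap _ (FractionRing (MvPolynomial (Fin (m + 1)) K ⧸ I)) (Ideal.Quotient.mk I f) /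
        algebraMap _ (FractionRing (MvPolynomial (Fin (m + 1)) K ⧸ I)) (Ideal.Quotient.mk I g)}

/-- The everywhere regular differentials of a function field `F` over `K`: those `ω ∈ Ω[F⁄K]` that,
for every valuation ring `V` of `F` that contains `K`, are of the form `∑ x_k dy_k` with
`x_k, y_k ∈ V`.  For `F` of transcendence degree one and `K` of characteristic zero, the nontrivial
`V` are the local rings of the smooth projective model `X` of `F`, and this is `H⁰(X, Ω_{X/K})`. -/
def regularDifferentials (K F : Type*) [Field K] [Field F] [Algebra K F] :
    Submodule K (Ω[F⁄K]) where
  carrier := {ω | ∀ V : ValuationSubring F, (∀ k : K, algebraMap K F k ∈ V) →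
    ω ∈ Submodule.span V.toSubring ((fun y : F => KaehlerDifferential.D K F y) '' (V : Set F))}
  add_mem' := fun h₁ h₂ V hV => Submodule.add_mem _ (h₁ V hV) (h₂ V hV)
  zero_mem' := fun _ _ => Submodule.zero_mem _
  smul_mem' := by
    intro k ω h V hV
    have h2 := Submodule.smul_mem _ (⟨algebraMap K F k, hV k⟩ : V.toSubring) (h V hV)
    have h3 : (⟨algebraMap K F k, hV k⟩ : V.toSubring) • ω = k • ω := by
      rw [← algebraMap_smul F (⟨algebraMap K F k, hV k⟩ : V.toSubring) ω, ← algebraMap_smul F k ω]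
      rfl
    rwa [h3] at h2

/-- The geometric genus of an integral projective curve, given by its homogeneous prime ideal: the
dimension of the space of everywhere regular differentials. -/
def geometricGenus {K : Type*} [Field K] {m : ℕ}
    (I : Ideal (MvPolynomial (Fin (m + 1)) K)) [I.IsPrime] : ℕ :=
  Module.finrank K (regularDifferentials K (projectiveFunctionField I))

end

-- Eliminating `c = a - z_0²` turns the affine curve into a tower of square roots over the line with
-- coordinate `x = z_0`: `z_k² = g_k` with `g_k = z_0² + ε_k z_{j(k)} - a` and `j(k) < k`, for `1 ≤
-- k ≤ m = N - 1`. Everything is proved by induction along this tower, adjoining one root at a time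
-- (`exists_isModel_and_isTower`).
--
-- The affine curve stays nonsingular. The coordinate ring `R` remains Dedekind as long as no `g_k`
-- lies in the square of a maximal ideal. If one did, the tangent vector of the stage already built
-- would be killed by the gradients of the earlier equations and of the new one, so that these
-- gradients would be dependent, against the Jacobian hypothesis
-- (`HasIndependentGradients.notMem_sq`). Throughout, `P = z_1 ⋯ z_m` and `D = P d/dx` is a
-- derivation of `R` without zeros; hence `dx / P` generates the differentials of the affine curve.
--
-- At infinity nothing ramifies. Since `g_k = x² + O(x)` is a square in `K((1/x))`, each place
-- splits in two. A function `u + w √g` has poles of order at most `d` there iff `u` has poles of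
-- order at most `d` and `w` of order at most `d - 1` (`mem_poleOrderLE_quadraticAlgebra`); this
-- gives the recursion `poleDim`. As `dx` has a double pole and `P` a pole of order `m` at infinity,
-- the regular differentials are the `h dx / P` with `h ∈ R` of pole order at most `m - 2`
-- (`IsModel.finite_and_finrank_regularDifferentials`). Solving the recursion gives the dimension
-- `(m - 2) 2^(m - 1) + 1` (`poleDim_sub_two`).
--
-- For the homogeneous ideal, consider `Z_0 ↦ t`, `Z_{k+1} ↦ z_k t` into the domain `R[t]`. The
-- kernel is prime, is the fiber ideal (`IsDescribedBy.fiberIdeal_eq`), and is generated by the `m`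
-- homogenized equations, by division with remainder by the last quadric at each stage. Krull's
-- theorem bounds its height above by `m`; a strict chain of primes, one per stage, bounds it below.

universe u

/-! ### Derivations, fraction fields and maximal ideals -/

section Derivations

/-- A derivation of a domain extends to its fraction field; the extension is given as a linear
form on the Kähler differentials. -/
theorem exists_linearMap_kaehlerDifferential_fractionRing {K R F : Type*} [CommRing K] [CommRing R]
    [Field F] [Algebra K R] [Algebra K F] [Algebra R F] [IsScalarTower K R F] [IsDomain R]
    [IsFractionRing R F] (D : Derivation K R R) :
    ∃ l : Ω[F⁄K] →ₗ[F] F, ∀ r : R,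
      l (KaehlerDifferential.D K F (algebraMap R F r)) = algebraMap R F (D r) := by
  let D₁ : Derivation K R F := (Algebra.linearMap R F).compDer D
  -- `Ω[F⁄K]` is the localization of `Ω[R⁄K]`, so the linear form of `D` extends once nonzero
  -- elements of `R` act invertibly on the target `F`.
  have hu : ∀ s : nonZeroDivisors R, IsUnit (algebraMap R (Module.End R F) s) := by
    intro s
    rw [Module.End.isUnit_iff]
    have hs : algebraMap R F s ≠ 0 := by
      simp
    refine ⟨fun x y h => ?_, fun y => ⟨(algebraMap R F s)⁻¹ * y, ?_⟩⟩
    · simp only [Module.algebraMap_end_apply, Algebra.smul_def] at h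
      exact mul_left_cancel₀ hs h
    · simp only [Module.algebraMap_end_apply, Algebra.smul_def]
      field_simp
  let l₀ := IsLocalizedModule.lift (nonZeroDivisors R) (KaehlerDifferential.map K K R F)
    D₁.liftKaehlerDifferential hu
  refine ⟨l₀.extendScalarsOfIsLocalization (nonZeroDivisors R) F, fun r => ?_⟩
  have h1 : KaehlerDifferential.map K K R F (KaehlerDifferential.D K R r)
      = KaehlerDifferential.D K F (algebraMap R F r) := KaehlerDifferential.map_D _ _ _ _ _
  rw [← h1]
  change l₀ _ = _
  rw [IsLocalizedModule.lift_apply, Derivation.liftKaehlerDifferential_comp_D]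
  rfl

theorem exists_derivation_fractionRing {K R F : Type*} [CommRing K] [CommRing R]
    [Field F] [Algebra K R] [Algebra K F] [Algebra R F] [IsScalarTower K R F] [IsDomain R]
    [IsFractionRing R F] (D : Derivation K R R) :
    ∃ d : Derivation K F F, ∀ r : R, d (algebraMap R F r) = algebraMap R F (D r) := by
  obtain ⟨l, hl⟩ := exists_linearMap_kaehlerDifferential_fractionRing (F := F) D
  exact ⟨l.compDer (KaehlerDifferential.D K F), hl⟩

theorem exists_derivation_fractionRing_inv {K R F : Type*} [CommRing K] [CommRing R]
    [Field F] [Algebra K R] [Algebra K F] [Algebra R F] [IsScalarTower K R F] [IsDomain R]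
    [IsFractionRing R F] (D : Derivation K R R) (t : R) (ht : D t = 1) :
    ∃ d : Derivation K F F, (∀ r : R, d (algebraMap R F r) = algebraMap R F (D r)) ∧
      d (algebraMap R F t)⁻¹ = - (algebraMap R F t)⁻¹ ^ 2 := by
  obtain ⟨d, hd⟩ := exists_derivation_fractionRing (F := F) D
  refine ⟨d, hd, ?_⟩
  rw [Derivation.leibniz_inv, hd, ht]
  simp

/-- In characteristic zero, a derivation that preserves a maximal ideal with algebraic residue field
maps everything into it. -/
theorem Derivation.apply_mem_of_forall_mem {K R : Type*} [Field K] [CharZero K] [CommRing R]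
    [Algebra K R] [Algebra.FiniteType K R] (D : Derivation K R R) (M : Ideal R) [M.IsMaximal]
    (h : ∀ y ∈ M, D y ∈ M) (y : R) : D y ∈ M := by
  let := Ideal.Quotient.field M
  have : Module.Finite K (R ⧸ M) := finite_of_finite_type_of_isJacobsonRing K (R ⧸ M)
  -- With `p` the minimal polynomial of the residue of `y`, `p(y) ∈ M` gives `p'(y) D y ∈ M`, and
  -- `p'(y) ∉ M` because `p` is separable.
  have hint : IsIntegral K (Ideal.Quotient.mk M y) := Algebra.IsIntegral.isIntegral _
  have hsep := (minpoly.irreducible hint).separable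
  have h0 : Polynomial.aeval y (minpoly K (Ideal.Quotient.mk M y)) ∈ M := by
    rw [← Ideal.Quotient.eq_zero_iff_mem]
    rw [← Ideal.Quotient.mkₐ_eq_mk K, ← Polynomial.aeval_algHom_apply]
    simp
  have h1 := h _ h0
  rw [Derivation.map_aeval, smul_eq_mul] at h1
  refine ((Ideal.IsMaximal.isPrime inferInstance).mem_or_mem h1).resolve_left fun h2 => ?_
  rw [← Ideal.Quotient.eq_zero_iff_mem, ← Ideal.Quotient.mkₐ_eq_mk K,
    ← Polynomial.aeval_algHom_apply] at h2
  exact hsep.aeval_derivative_ne_zero (by simp) h2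

/-- In a Dedekind domain of finite type over a field of characteristic zero, an element that
vanishes together with its derivative at a maximal ideal lies in the square of that ideal, if the
derivation does not vanish there. -/
theorem Derivation.mem_sq_of_mem_of_apply_mem {K R : Type*} [Field K] [CharZero K] [CommRing R]
    [IsDedekindDomain R] [Algebra K R] [Algebra.FiniteType K R] (D : Derivation K R R)
    (hD : Ideal.span (Set.range D) = ⊤) (M : Ideal R) [hM : M.IsMaximal] {g : R} (hg : g ∈ M)
    (hDg : D g ∈ M) : g ∈ M ^ 2 := by
  rcases eq_or_ne M ⊥ with rfl | hbot
  · simp_all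
  obtain ⟨p, hp, hp2⟩ : ∃ p ∈ M, p ∉ M ^ 2 :=
    SetLike.exists_of_lt (M.pow_lt_self hbot hM.ne_top 2 le_rfl)
  -- No ideal lies strictly between `M ^ 2` and `M`, so `p` is a uniformizer at `M`.
  have hsup : Ideal.span {p} ⊔ M ^ 2 = M := by
    have := Ideal.eq_prime_pow_of_succ_lt_of_le (P := M) hbot (i := 1)
      (I := Ideal.span {p} ⊔ M ^ 2)
      (lt_of_le_of_ne le_sup_right fun h => hp2 (by
        change p ∈ M ^ (1 + 1)
        rw [h]; exact Ideal.mem_sup_left (Ideal.mem_span_singleton_self p)))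
      (by
        rw [pow_one, sup_le_iff, Ideal.span_singleton_le_iff_mem]
        exact ⟨hp, Ideal.pow_le_self two_ne_zero⟩)
    rwa [pow_one] at this
  have hsq : ∀ b ∈ M ^ 2, D b ∈ M := by
    intro b hb
    rw [pow_two] at hb
    refine Submodule.mul_induction_on hb (fun x hx y hy => ?_) (fun x y hx hy => ?_)
    · rw [Derivation.leibniz]
      exact add_mem (M.mul_mem_right _ hx) (M.mul_mem_right _ hy)
    · rw [map_add]; exact add_mem hx hy
  have hdecomp : ∀ y ∈ M, ∃ s, ∃ b ∈ M ^ 2, y = s * p + b := by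
    intro y hy
    rw [← hsup, Submodule.mem_sup] at hy
    obtain ⟨c, hc, b, hb, rfl⟩ := hy
    obtain ⟨s, rfl⟩ := Ideal.mem_span_singleton'.1 hc
    exact ⟨s, b, hb, rfl⟩
  have hDy : ∀ s b, b ∈ M ^ 2 → (D (s * p + b) ∈ M ↔ s * D p ∈ M) := by
    intro s b hb
    rw [map_add, Derivation.leibniz, smul_eq_mul, smul_eq_mul, add_assoc]
    exact add_mem_cancel_right (add_mem (M.mul_mem_right _ hp) (hsq b hb))
  obtain ⟨s, b, hb, rfl⟩ := hdecomp g hg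
  rw [hDy s b hb] at hDg
  rcases hM.isPrime.mem_or_mem hDg with h | h
  · refine add_mem ?_ hb
    rw [pow_two]
    exact Ideal.mul_mem_mul h hp
  · exfalso
    -- If `D p ∈ M`, then `D` preserves `M`, hence maps all of `R` into `M`, against `hD`.
    have hall : ∀ y ∈ M, D y ∈ M := by
      intro y hy
      obtain ⟨s, b, hb, rfl⟩ := hdecomp y hy
      exact (hDy s b hb).2 (M.mul_mem_left _ h)
    refine hM.ne_top (top_le_iff.1 (hD ▸ Ideal.span_le.2 ?_))
    rintro _ ⟨y, rfl⟩
    exact D.apply_mem_of_forall_mem M hall y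

end Derivations

/-! ### Laurent series: the model of a place at infinity -/

section Laurent

open LaurentSeries PowerSeries

variable (K : Type u) [Field K]

/-- The power series, as a valuation ring of the field of Laurent series. -/
noncomputable def powerSeriesSubring : ValuationSubring K⸨X⸩ :=
  (Valued.v : Valuation K⸨X⸩ (WithZero (Multiplicative ℤ))).valuationSubring

variable {K}

theorem mem_powerSeriesSubring {f : K⸨X⸩} :
    f ∈ powerSeriesSubring K ↔ ∃ p : K⟦X⟧, (p : K⸨X⸩) = f :=
  val_le_one_iff_eq_coe K f

theorem algebraMap_mem_powerSeriesSubring (k : K) :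
    algebraMap K K⸨X⸩ k ∈ powerSeriesSubring K :=
  mem_powerSeriesSubring.2 ⟨PowerSeries.C k, by
    rw [coe_C, LaurentSeries.algebraMap_apply]⟩

variable (K) in
/-- The inverse of the variable, a Laurent series. -/
noncomputable def laurentXInv : K⸨X⸩ := ((X : K⟦X⟧) : K⸨X⸩)⁻¹

theorem coe_X_ne_zero : ((X : K⟦X⟧) : K⸨X⸩) ≠ 0 := by
  intro h
  exact PowerSeries.X_ne_zero ((HahnSeries.ofPowerSeries_injective (Γ := ℤ)) (h.trans (map_zero _).symm))

theorem laurentXInv_notMem : laurentXInv K ∉ powerSeriesSubring K := by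
  intro h
  obtain ⟨p, hp⟩ := mem_powerSeriesSubring.1 h
  have h1 : (((p * X : K⟦X⟧)) : K⸨X⸩) = ((1 : K⟦X⟧) : K⸨X⸩) := by
    rw [PowerSeries.coe_mul, hp, laurentXInv, inv_mul_cancel₀ coe_X_ne_zero, PowerSeries.coe_one]
  have h2 := congrArg PowerSeries.constantCoeff ((HahnSeries.ofPowerSeries_injective (Γ := ℤ)) h1)
  simp at h2

theorem one_lt_valuation_laurentXInv :
    1 < (powerSeriesSubring K).valuation (laurentXInv K) := by
  rw [← not_le, ValuationSubring.valuation_le_one_iff]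
  exact laurentXInv_notMem

/-- A power series with constant coefficient `1` is a square. -/
theorem PowerSeries.exists_sq_eq [CharZero K] (q : K⟦X⟧) : ∃ w : K⟦X⟧, w ^ 2 = 1 + X * q := by
  -- Hensel's lemma for `Y² - (1 + X q)` at the approximate root `1`, where the derivative `2` is a
  -- unit.
  have : HenselianRing K⟦X⟧ (Ideal.span {X}) := inferInstance
  obtain ⟨w, hw, -⟩ := HenselianRing.is_henselian (I := Ideal.span {(X : K⟦X⟧)})
    (Polynomial.X ^ 2 - Polynomial.C (1 + X * q)) (Polynomial.monic_X_pow_sub_C _ two_ne_zero) 1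
    (by
      simp only [Polynomial.eval_sub, Polynomial.eval_pow, Polynomial.eval_X, Polynomial.eval_C]
      exact Ideal.mem_span_singleton.2 ⟨-q, by ring⟩)
    (by
      refine IsUnit.map _ ?_
      have : IsUnit ((PowerSeries.C (2 : K))) := IsUnit.map _ (isUnit_iff_ne_zero.2 two_ne_zero)
      convert this using 1
      simpa [one_add_one_eq_two] using (map_ofNat (PowerSeries.C (R := K)) 2).symm)
  refine ⟨w, ?_⟩
  simpa [sub_eq_zero] using hw

/-- If `h - t⁻²` has at most a simple pole, then `h` is a square. -/
theorem exists_sq_eq_laurent [CharZero K] {h : K⸨X⸩}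
    (hh : (powerSeriesSubring K).valuation (h - laurentXInv K ^ 2) ≤
      (powerSeriesSubring K).valuation (laurentXInv K)) : ∃ w, w ^ 2 = h := by
  have hX : laurentXInv K ≠ 0 := inv_ne_zero coe_X_ne_zero
  have h1 : (h - laurentXInv K ^ 2) / laurentXInv K ∈ powerSeriesSubring K := by
    rw [← ValuationSubring.valuation_le_one_iff, map_div₀]
    exact div_le_one_of_le₀ hh zero_le
  -- With `t` the variable, this says `h = t⁻² (1 + t q)`.
  obtain ⟨q, hq⟩ := mem_powerSeriesSubring.1 h1
  obtain ⟨w, hw⟩ := PowerSeries.exists_sq_eq q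
  refine ⟨(w : K⸨X⸩) * laurentXInv K, ?_⟩
  rw [mul_pow, ← PowerSeries.coe_pow, hw, PowerSeries.coe_add, PowerSeries.coe_mul, hq,
    PowerSeries.coe_one, show ((X : K⟦X⟧) : K⸨X⸩) = (laurentXInv K)⁻¹ from (inv_inv _).symm]
  field_simp
  ring

end Laurent

/-- `L` is a field with a valuation ring `V ⊇ K` and an element `s` with a pole, like `K((t))`
with `K[[t]]` and `s = t⁻¹`: elements `s² + O(s)` are squares, and `d = d/dt` preserves `V`. -/
structure IsPlaceAtInfinity {K L : Type*} [Field K] [Field L] [Algebra K L]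
    (V : ValuationSubring L) (s : L) (d : Derivation K L L) : Prop where
  algebraMap_mem : ∀ k : K, algebraMap K L k ∈ V
  one_lt : 1 < V.valuation s
  exists_sq_eq : ∀ h : L, V.valuation (h - s ^ 2) ≤ V.valuation s → ∃ w, w ^ 2 = h
  derivation_mem : ∀ f ∈ V, d f ∈ V
  derivation_apply : d s = - s ^ 2

open LaurentSeries PowerSeries in
-- Realized by `K((t))` with `V = K[[t]]`, `s = t⁻¹` and `d = d/dt`. All later arguments use only
-- the properties recorded in `IsPlaceAtInfinity`.
theorem exists_isPlaceAtInfinity (K : Type u) [Field K] [CharZero K] :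
    ∃ (L : Type u) (_ : Field L) (_ : Algebra K L) (V : ValuationSubring L) (s : L)
      (d : Derivation K L L), IsPlaceAtInfinity V s d := by
  have : @IsScalarTower K K⟦X⟧ K⸨X⸩ Algebra.toSMul Algebra.toSMul Algebra.toSMul :=
    IsScalarTower.of_algebraMap_eq fun _ => rfl
  obtain ⟨d, hd, hdX⟩ := exists_derivation_fractionRing_inv (F := K⸨X⸩)
    (PowerSeries.derivative (R := K)) X PowerSeries.derivative_X
  refine ⟨K⸨X⸩, inferInstance, inferInstance, powerSeriesSubring K, laurentXInv K, d,
    algebraMap_mem_powerSeriesSubring, one_lt_valuation_laurentXInv,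
    fun _ => exists_sq_eq_laurent, fun f hf => ?_, ?_⟩
  · obtain ⟨p, rfl⟩ := mem_powerSeriesSubring.1 hf
    exact mem_powerSeriesSubring.2 ⟨_, (hd p).symm⟩
  · exact hdX

/-! ### Valuations of `X² + O(X)` and of its square roots -/

section Valuation

variable {L Γ : Type*} [Field L] [LinearOrderedCommGroupWithZero Γ] (v : Valuation L Γ)

theorem Valuation.map_eq_sq_of_map_sub_le {X g : L} (hX : 1 < v X) (hg : v (g - X ^ 2) ≤ v X) :
    v g = v X ^ 2 := by
  have : v (g - X ^ 2) < v (X ^ 2) := by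
    rw [map_pow]
    exact hg.trans_lt (by simpa using pow_lt_pow_right₀ hX one_lt_two)
  rw [← map_pow]
  simpa using Valuation.map_add_eq_of_lt_left v this

theorem Valuation.map_eq_of_sq_eq {X g w : L} (hw : w ^ 2 = g) (hg : v g = v X ^ 2) :
    v w = v X := by
  rw [← hw, map_pow] at hg
  exact (pow_left_inj₀ zero_le zero_le two_ne_zero).1 hg

end Valuation

/-! ### Pole orders, models, and the affine line -/

section Models

/-- The elements whose poles at the places above infinity have order at most `d`. -/
noncomputable def poleOrderLE {K L R : Type*} [Field K] [Field L] [Algebra K L]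
    {V : ValuationSubring L} {s : L} {δ : Derivation K L L} (hV : IsPlaceAtInfinity V s δ)
    [CommRing R] [Algebra K R] (x : R) (d : ℤ) : Submodule K R where
  carrier := {h | ∀ τ : R →ₐ[K] L, τ x = s → V.valuation (τ h) ≤ V.valuation s ^ d}
  add_mem' := fun {a b} ha hb τ hτ => by
    rw [map_add]
    exact (V.valuation.map_add _ _).trans (max_le (ha τ hτ) (hb τ hτ))
  zero_mem' := fun τ _ => by simp
  smul_mem' := fun k h hh τ hτ => by
    rw [map_smul, Algebra.smul_def, map_mul]
    calc _ ≤ 1 * V.valuation s ^ d := by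
          gcongr
          · exact (V.valuation_le_one_iff _).2 (hV.algebraMap_mem k)
          · exact hh τ hτ
      _ = _ := one_mul _

/-- The dimension of the space of functions with poles of order at most `d` at infinity, on a curve
obtained from the line by adjoining `m` square roots. -/
def poleDim : ℕ → ℤ → ℕ
  | 0, d => (d + 1).toNat
  | m + 1, d => poleDim m d + poleDim m (d - 1)

/-- `R` is the coordinate ring of a nonsingular affine curve obtained from the line with coordinate
`x` by adjoining `m` square roots, with product `P`, of functions of the form `x² + O(x)`, and `D`
is the derivation `P d/dx`. -/
structure IsModel {K L : Type u} [Field K] [Field L] [Algebra K L]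
    {V : ValuationSubring L} {s : L} {δ : Derivation K L L} (hV : IsPlaceAtInfinity V s δ)
    {R : Type u} [CommRing R] [Algebra K R] (x P : R) (D : Derivation K R R) (m : ℕ) : Prop where
  finiteType : Algebra.FiniteType K R
  isDedekindDomain : IsDedekindDomain R
  span_range : Ideal.span (Set.range D) = ⊤
  apply_x : D x = P
  ne_zero : P ≠ 0
  -- The identity `P dy = (D y) dx`. It is needed for the universal derivation of the function field
  -- and for `δ` on `L`; quantifying over all `f` lets it restrict to the lower stages of the tower.
  deriv_eq : ∀ {A M : Type u} [CommRing A] [Algebra K A] [AddCommGroup M] [Module K M] [Module A M]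
    (f : R →ₐ[K] A) (d : Derivation K A M) (y : R), f P • d (f y) = f (D y) • d (f x)
  injective : ∀ τ : R →ₐ[K] L, τ x = s → Function.Injective τ
  eq_zero : ∀ d < 0, ∀ h ∈ poleOrderLE hV x d, h = 0
  finite : ∀ d, Module.Finite K (poleOrderLE hV x d)
  finrank : ∀ d, Module.finrank K (poleOrderLE hV x d) = poleDim m d
  -- The remaining fields concern arbitrary valuation rings, because regularity of a differential is
  -- tested on all of them, not only on those obtained from maps to `L`.
  apply_mem : ∀ {E : Type u} [Field E] [Algebra K E] (W : ValuationSubring E),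
    (∀ k : K, algebraMap K E k ∈ W) → ∀ f : R →ₐ[K] E, f x ∈ W → ∀ y, f y ∈ W
  valuation_le : ∀ {E : Type u} [Field E] [Algebra K E] (W : ValuationSubring E),
    (∀ k : K, algebraMap K E k ∈ W) → ∀ f : R →ₐ[K] E, 1 < W.valuation (f x) →
      ∀ d, ∀ h ∈ poleOrderLE hV x d, W.valuation (f h) ≤ W.valuation (f x) ^ d
  valuation_eq : ∀ {E : Type u} [Field E] [Algebra K E] (W : ValuationSubring E),
    (∀ k : K, algebraMap K E k ∈ W) → ∀ f : R →ₐ[K] E, 1 < W.valuation (f x) →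
      W.valuation (f P) = W.valuation (f x) ^ m

variable {K L : Type u} [Field K] [Field L] [Algebra K L]
  {V : ValuationSubring L} {s : L} {δ : Derivation K L L} (hV : IsPlaceAtInfinity V s δ)

/-- Nonzero constants have valuation one, being in `W` together with their inverses, so the leading
term dominates strictly. -/
theorem Polynomial.valuation_aeval_of_forall_mem {E : Type*} [Field E] [Algebra K E]
    {W : ValuationSubring E} (hW : ∀ k : K, algebraMap K E k ∈ W) {w : E}
    (hw : 1 < W.valuation w) {p : Polynomial K} (hp : p ≠ 0) :
    W.valuation (Polynomial.aeval w p) = W.valuation w ^ p.natDegree := by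
  have : W.valuation.IsTrivialOn K := ⟨fun a ha => le_antisymm
    ((W.valuation_le_one_iff _).2 (hW a)) (by
      have h := (W.valuation_le_one_iff _).2 (hW a⁻¹)
      rw [map_inv₀, map_inv₀] at h
      exact (inv_le_one₀ (by simpa [zero_lt_iff] using ha)).1 h)⟩
  exact Polynomial.valuation_aeval_eq_valuation_X_pow_natDegree_of_one_lt_valuation_X w hw hp

theorem IsPlaceAtInfinity.ne_zero (hV : IsPlaceAtInfinity V s δ) : s ≠ 0 := by
  rintro rfl
  simpa using hV.one_lt

/-- On the line the pole order at infinity is the degree. `degreeLT` is a strict bound, whence `d +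
1`; truncation by `toNat` leaves only zero for negative `d`. -/
theorem mem_poleOrderLE_X {p : Polynomial K} {d : ℤ} :
    p ∈ poleOrderLE hV Polynomial.X d ↔ p ∈ Polynomial.degreeLT K (d + 1).toNat := by
  rcases eq_or_ne p 0 with rfl | hp
  · simp
  have key : p ∈ poleOrderLE hV Polynomial.X d ↔ (p.natDegree : ℤ) ≤ d := by
    have hval := Polynomial.valuation_aeval_of_forall_mem hV.algebraMap_mem hV.one_lt hp
    rw [← zpow_natCast] at hval
    constructor
    · intro h
      have := h (Polynomial.aeval s) (Polynomial.aeval_X _)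
      rwa [hval, zpow_le_zpow_iff_right₀ hV.one_lt] at this
    · intro h τ hτ
      obtain rfl : τ = Polynomial.aeval s := Polynomial.algHom_ext (by simpa using hτ)
      rwa [hval, zpow_le_zpow_iff_right₀ hV.one_lt]
  rw [key, Polynomial.mem_degreeLT, Polynomial.degree_eq_natDegree hp, Nat.cast_lt]
  omega

/-- The affine line. -/
theorem isModel_polynomial :
    IsModel hV (R := Polynomial K) Polynomial.X 1 Polynomial.derivative' 0 where
  finiteType := inferInstance
  isDedekindDomain := inferInstance
  span_range := by
    rw [Ideal.eq_top_iff_one]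
    exact Ideal.subset_span ⟨Polynomial.X, by simp⟩
  apply_x := by simp
  ne_zero := one_ne_zero
  deriv_eq f d y := by
    obtain ⟨a, rfl⟩ : ∃ a, f = Polynomial.aeval a :=
      ⟨f Polynomial.X, Polynomial.algHom_ext (by simp)⟩
    simp [Derivation.map_aeval]
  injective τ hτ := by
    obtain rfl : τ = Polynomial.aeval s := Polynomial.algHom_ext (by simpa using hτ)
    refine (injective_iff_map_eq_zero _).2 fun p hp => by_contra fun h0 => ?_
    have := Polynomial.valuation_aeval_of_forall_mem hV.algebraMap_mem hV.one_lt h0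
    rw [hp, map_zero] at this
    exact pow_ne_zero _ ((V.valuation.ne_zero_iff).2 hV.ne_zero) this.symm
  eq_zero d hd h hh := by
    rw [mem_poleOrderLE_X, Int.toNat_of_nonpos (by omega)] at hh
    simpa using Polynomial.mem_degreeLT.1 hh
  finite d := by
    have : poleOrderLE hV Polynomial.X d = Polynomial.degreeLT K (d + 1).toNat :=
      Submodule.ext fun p => mem_poleOrderLE_X hV
    rw [this]
    exact Module.Finite.equiv (Polynomial.degreeLTEquiv K _).symm
  finrank d := by
    have : poleOrderLE hV Polynomial.X d = Polynomial.degreeLT K (d + 1).toNat :=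
      Submodule.ext fun p => mem_poleOrderLE_X hV
    rw [this, (Polynomial.degreeLTEquiv K _).finrank_eq]
    simp [poleDim]
  apply_mem W hW f hf y := by
    rw [show f = Polynomial.aeval (f Polynomial.X) from Polynomial.algHom_ext (by simp),
      Polynomial.aeval_eq_sum_range]
    refine sum_mem fun i _ => ?_
    rw [Algebra.smul_def]
    exact mul_mem (hW _) (pow_mem hf _)
  valuation_le W hW f hf d h hh := by
    rcases eq_or_ne h 0 with rfl | h0
    · simp
    have hdeg : (h.natDegree : ℤ) ≤ d := by
      rw [mem_poleOrderLE_X, Polynomial.mem_degreeLT, Polynomial.degree_eq_natDegree h0,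
        Nat.cast_lt] at hh
      omega
    rw [show f h = Polynomial.aeval (f Polynomial.X) h by
      congr 1; exact Polynomial.algHom_ext (by simp),
      Polynomial.valuation_aeval_of_forall_mem hW hf h0, ← zpow_natCast]
    exact zpow_le_zpow_right₀ hf.le hdeg
  valuation_eq W hW f hf := by simp

end Models

/-! ### Quadratic algebras `R[√g]` over Dedekind domains -/

section QuadraticAlgebra

open QuadraticAlgebra

theorem QuadraticAlgebra.omega_sq {R : Type*} [CommRing R] (g : R) :
    (omega : QuadraticAlgebra R g 0) ^ 2 = algebraMap R _ g := by
  rw [pow_two, omega_mul_omega_eq_algebraMap]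
  simp

theorem QuadraticAlgebra.eq_algebraMap_add {R : Type*} [CommRing R] {g : R}
    (y : QuadraticAlgebra R g 0) :
    y = algebraMap R _ y.re + algebraMap R _ y.im * omega := by
  rw [← Algebra.smul_def]
  exact mk_eq_add_smul_omega y.re y.im

/-- A square root of `g` in the fraction field is integral over `R`, hence already in `R`. -/
theorem sq_ne_algebraMap {R F : Type*} [CommRing R] [IsDomain R]
    [IsIntegrallyClosed R] [Field F] [Algebra R F] [IsFractionRing R F] {g : R}
    (hg : ∀ u : R, u ^ 2 ≠ g) (u : F) : u ^ 2 ≠ algebraMap R F g := by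
  intro hu
  have hint : IsIntegral R u := by
    refine IsIntegral.of_pow two_pos ?_
    rw [hu]; exact isIntegral_algebraMap
  obtain ⟨r, rfl⟩ := IsIntegrallyClosed.isIntegral_iff.1 hint
  rw [← map_pow] at hu
  exact hg r (IsFractionRing.injective R F hu)

/-- The norm of `p + q √g` is `p² - g q²`; if it vanishes with `q ≠ 0`, then `p / q` is a square
root of `g` in the fraction field. -/
theorem QuadraticAlgebra.eq_zero_of_norm_eq_zero {R : Type*} [CommRing R] [IsDomain R]
    [IsIntegrallyClosed R] {g : R} (hg : ∀ u : R, u ^ 2 ≠ g) {y : QuadraticAlgebra R g 0}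
    (hy : y.norm = 0) : y = 0 := by
  rw [norm_def] at hy
  by_cases h0 : y.im = 0
  · rw [h0] at hy
    ext
    · simpa using hy
    · exact h0
  · exfalso
    have h1 : algebraMap R (FractionRing R) y.im ≠ 0 := by simpa using h0
    refine sq_ne_algebraMap (F := FractionRing R) hg
      (algebraMap _ _ y.re / algebraMap _ _ y.im) ?_
    have h2 : y.re ^ 2 = g * y.im ^ 2 := by linear_combination hy
    rw [div_pow, ← map_pow, h2, map_mul, map_pow]
    field_simp

/-- A quadratic algebra `R[√g]` is a domain if `R` is integrally closed and `g` is not a square. -/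
theorem QuadraticAlgebra.isDomain_of_forall_sq_ne {R : Type*} [CommRing R] [IsDomain R]
    [IsIntegrallyClosed R] {g : R} (hg : ∀ u : R, u ^ 2 ≠ g) :
    IsDomain (QuadraticAlgebra R g 0) := by
  have : NoZeroDivisors (QuadraticAlgebra R g 0) := ⟨fun {y w} hyw => by
    have h := congrArg QuadraticAlgebra.norm hyw
    rw [map_mul, QuadraticAlgebra.norm_zero, mul_eq_zero] at h
    exact h.imp (eq_zero_of_norm_eq_zero hg) (eq_zero_of_norm_eq_zero hg)⟩
  exact NoZeroDivisors.to_isDomain _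

/-- The extension of scalars of a quadratic algebra to an algebra over its base ring. -/
@[simps]
def QuadraticAlgebra.mapAlgebra {R : Type*} (F : Type*) [CommRing R] [CommRing F] [Algebra R F]
    (g : R) : QuadraticAlgebra R g 0 →+* QuadraticAlgebra F (algebraMap R F g) 0 where
  toFun y := ⟨algebraMap R F y.re, algebraMap R F y.im⟩
  map_one' := by ext <;> simp
  map_zero' := by ext <;> simp
  map_add' y w := by ext <;> simp
  map_mul' y w := by ext <;> simp

/-- Conjugation is an `R`-automorphism, so the conjugate of `e` is integral too, and with it the
trace and the norm. -/
theorem QuadraticAlgebra.isIntegral_two_mul_re_and_norm {R F : Type*} [CommRing R] [Field F]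
    [Algebra R F] {c : F} {e : QuadraticAlgebra F c 0} (he : IsIntegral R e) :
    IsIntegral R (2 * e.re) ∧ IsIntegral R e.norm := by
  have hstar : IsIntegral R (star e) := by
    let σ : QuadraticAlgebra F c 0 →ₐ[R] QuadraticAlgebra F c 0 :=
      { starRingEnd (QuadraticAlgebra F c 0) with
        commutes' r := by
          ext <;> simp [starRingEnd_apply, IsScalarTower.algebraMap_apply R F (QuadraticAlgebra F c 0)] }
    exact he.map σ
  constructor
  · have h1 := he.add hstar
    rw [← algebraMap_trace_eq_add_star,
      isIntegral_algebraMap_iff (A := F) algebraMap_injective] at h1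
    simpa [trace_def] using h1
  · have h1 := he.mul hstar
    rwa [← algebraMap_norm_eq_mul_star,
      isIntegral_algebraMap_iff (A := F) algebraMap_injective] at h1

/-- If `b² g` is integral, where `g` is squarefree, then `b` is integral. -/
theorem IsDedekindDomain.mem_range_of_mul_sq_mem_range {R F : Type*} [CommRing R]
    [IsDedekindDomain R] [Field F] [Algebra R F] [IsFractionRing R F] {g : R}
    (hg : ∀ M : Ideal R, M.IsMaximal → g ∉ M ^ 2) {b : F}
    (hb : algebraMap R F g * b ^ 2 ∈ (algebraMap R F).range) : b ∈ (algebraMap R F).range := by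
  refine HeightOneSpectrum.mem_integers_of_valuation_le_one F b fun v => ?_
  by_contra! hlt
  refine hg v.asIdeal v.isMaximal ((v.intValuation_le_pow_iff_mem g 2).1 ?_)
  obtain ⟨r, hr⟩ := hb
  have h1 : v.valuation F (algebraMap R F g) * v.valuation F b ^ 2 ≤ 1 := by
    rw [← map_pow, ← map_mul, ← hr]
    exact v.valuation_le_one r
  rw [v.valuation_of_algebraMap] at h1
  -- The valuation is discrete: a pole of `b` makes `b²` have a pole of order at least two, which
  -- `g` can cancel only by vanishing to order two.
  have h2 : WithZero.exp (1 : ℤ) ≤ v.valuation F b := by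
    have hb0 : v.valuation F b ≠ 0 := (zero_lt_one.trans hlt).ne'
    rw [← WithZero.exp_log hb0, WithZero.exp_le_exp]
    rw [← WithZero.exp_log hb0, ← WithZero.exp_zero, WithZero.exp_lt_exp] at hlt
    omega
  have h3 : v.intValuation g * WithZero.exp (2 : ℤ) ≤ 1 := by
    refine le_trans ?_ h1
    gcongr
    rw [show (2 : ℤ) = 1 + 1 by rfl, WithZero.exp_add, pow_two]
    gcongr
  have h4 := mul_le_mul_left h3 (WithZero.exp (-2 : ℤ))
  rwa [mul_assoc, ← WithZero.exp_add, one_mul, add_neg_cancel, WithZero.exp_zero, mul_one] at h4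

/-- A quadratic algebra `R[√g]` over a Dedekind domain is a Dedekind domain if `2` is invertible
and `g` is squarefree at all primes and not a square. -/
theorem QuadraticAlgebra.isDedekindDomain {R : Type*} [CommRing R] [IsDedekindDomain R] {g : R}
    (h2 : IsUnit (2 : R)) (hg : ∀ u : R, u ^ 2 ≠ g)
    (hg2 : ∀ M : Ideal R, M.IsMaximal → g ∉ M ^ 2) :
    IsDedekindDomain (QuadraticAlgebra R g 0) := by
  have hdom : IsDomain (QuadraticAlgebra R g 0) := isDomain_of_forall_sq_ne hg
  have hnoeth : IsNoetherianRing (QuadraticAlgebra R g 0) :=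
    IsNoetherianRing.of_finite R _
  have hdim : Ring.DimensionLEOne (QuadraticAlgebra R g 0) :=
    Ring.DimensionLEOne.of_isIntegral R _
  have hic : IsIntegrallyClosed (QuadraticAlgebra R g 0) := by
    have : Fact (∀ r : FractionRing R, r ^ 2 ≠ algebraMap R (FractionRing R) g + 0 * r) :=
      ⟨fun r => by rw [zero_mul, add_zero]; exact sq_ne_algebraMap hg r⟩
    let : Algebra (QuadraticAlgebra R g 0)
      (QuadraticAlgebra (FractionRing R) (algebraMap R (FractionRing R) g) 0) :=
      (mapAlgebra (FractionRing R) g).toAlgebra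
    have hmap : ∀ y, algebraMap (QuadraticAlgebra R g 0)
      (QuadraticAlgebra (FractionRing R) (algebraMap R (FractionRing R) g) 0) y =
      ⟨algebraMap R _ y.re, algebraMap R _ y.im⟩ := fun _ => rfl
    have : IsScalarTower R (QuadraticAlgebra R g 0)
      (QuadraticAlgebra (FractionRing R) (algebraMap R (FractionRing R) g) 0) :=
      IsScalarTower.of_algebraMap_eq fun r => by
        rw [hmap]
        ext <;> simp [IsScalarTower.algebraMap_apply R (FractionRing R)
          (QuadraticAlgebra (FractionRing R) (algebraMap R (FractionRing R) g) 0)]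
    have hinj : FaithfulSMul (QuadraticAlgebra R g 0)
        (QuadraticAlgebra (FractionRing R) (algebraMap R (FractionRing R) g) 0) := by
      rw [faithfulSMul_iff_algebraMap_injective]
      intro y w h
      rw [hmap, hmap, QuadraticAlgebra.mk.injEq] at h
      exact QuadraticAlgebra.ext (IsFractionRing.injective R _ h.1)
        (IsFractionRing.injective R _ h.2)
    have hfrac : IsFractionRing (QuadraticAlgebra R g 0)
        (QuadraticAlgebra (FractionRing R) (algebraMap R (FractionRing R) g) 0) := by
      classical
      refine IsFractionRing.of_field _ _ fun e => ?_
      obtain ⟨b, hb⟩ := IsLocalization.exist_integer_multiples_of_finset (nonZeroDivisors R)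
        (insert e.re {e.im} : Finset (FractionRing R))
      obtain ⟨p, hp⟩ := hb e.re (by simp)
      obtain ⟨q, hq⟩ := hb e.im (by simp)
      refine ⟨⟨p, q⟩, algebraMap R _ b, ?_⟩
      have hb0 : algebraMap R (FractionRing R) b ≠ 0 := by simp
      have hb1 : algebraMap (FractionRing R) (QuadraticAlgebra (FractionRing R)
          (algebraMap R (FractionRing R) g) 0) (algebraMap R (FractionRing R) b) ≠ 0 := by
        simp
      rw [← IsScalarTower.algebraMap_apply R _ (QuadraticAlgebra (FractionRing R)
          (algebraMap R (FractionRing R) g) 0),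
        IsScalarTower.algebraMap_apply R (FractionRing R) (QuadraticAlgebra (FractionRing R)
          (algebraMap R (FractionRing R) g) 0), hmap, eq_div_iff hb1, mul_comm,
        ← Algebra.smul_def]
      ext
      · simp [hp, Algebra.smul_def]
      · simp [hq, Algebra.smul_def]
    rw [isIntegrallyClosed_iff
      (QuadraticAlgebra (FractionRing R) (algebraMap R (FractionRing R) g) 0)]
    intro e he
    -- For `e = p + q √g`, the trace `2p` puts `p` in `R`; then `g q² = p² - N(e)` is in `R`, and
    -- squarefreeness of `g` puts `q` in `R`.
    obtain ⟨htr, hnorm⟩ := isIntegral_two_mul_re_and_norm (isIntegral_trans (R := R) e he)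
    obtain ⟨c, hc⟩ := h2.exists_left_inv
    have hcF : algebraMap R (FractionRing R) c * 2 = 1 := by
      rw [← map_ofNat (algebraMap R (FractionRing R)) 2, ← map_mul, hc, map_one]
    have hre : IsIntegral R e.re := by
      have := (isIntegral_algebraMap (R := R) (A := FractionRing R) (x := c)).mul htr
      rwa [← mul_assoc, hcF, one_mul] at this
    obtain ⟨p, hp⟩ := IsIntegrallyClosed.isIntegral_iff.1 hre
    have hsq : IsIntegral R (algebraMap R (FractionRing R) g * e.im ^ 2) := by
      have h3 := (hre.pow 2).sub hnorm
      rw [norm_def] at h3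
      refine (congrArg (IsIntegral R) ?_).mp h3
      ring
    obtain ⟨q, hq⟩ := IsDedekindDomain.mem_range_of_mul_sq_mem_range hg2
      (IsIntegrallyClosed.isIntegral_iff.1 hsq)
    exact ⟨⟨p, q⟩, by rw [hmap]; exact QuadraticAlgebra.ext hp hq⟩
  exact { hdom, hnoeth, hdim, hic with }

end QuadraticAlgebra

/-! ### Adjoining one square root to a model -/

section Step

open QuadraticAlgebra

/-- The derivation `√g D` of a quadratic algebra `R[√g]`. -/
noncomputable def QuadraticAlgebra.derivationOmegaMul {K R : Type*} [Field K] [CharZero K]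
    [CommRing R] [Algebra K R] (D : Derivation K R R) (g : R) :
    Derivation K (QuadraticAlgebra R g 0) (QuadraticAlgebra R g 0) :=
  Derivation.mk'
    -- Since `D √g = D g / (2 √g)`, the factor `√g` clears the denominator: `√g D(u + w √g) = (g D w
    -- + w D g / 2) + (D u) √g`.
    { toFun := fun y => ⟨g * D y.im + algebraMap K R 2⁻¹ * (y.im * D g), D y.re⟩
      map_add' := fun y w => by
        ext
        · simp only [re_add, im_add, map_add]; ring
        · simp
      map_smul' := fun k y => by
        ext
        · simp only [im_smul, Derivation.map_smul, RingHom.id_apply, re_smul]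
          simp only [Algebra.smul_def]
          ring
        · simp }
    (fun y w => by
      have h2 : algebraMap K R 2⁻¹ * 2 = 1 := by
        rw [← map_ofNat (algebraMap K R) 2, ← map_mul, inv_mul_cancel₀ two_ne_zero, map_one]
      ext
      · simp only [LinearMap.coe_mk, AddHom.coe_mk, smul_eq_mul, re_add, re_mul, im_mul, map_add,
          Derivation.leibniz, zero_mul, add_zero]
        ring
      · simp only [LinearMap.coe_mk, AddHom.coe_mk, smul_eq_mul, im_add, re_mul, im_mul, map_add,
          Derivation.leibniz, zero_mul, add_zero]
        linear_combination (- y.im * w.im * D g) * h2)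

theorem QuadraticAlgebra.derivationOmegaMul_apply {K R : Type*} [Field K] [CharZero K]
    [CommRing R] [Algebra K R] (D : Derivation K R R) (g : R) (y : QuadraticAlgebra R g 0) :
    derivationOmegaMul D g y =
      ⟨g * D y.im + algebraMap K R 2⁻¹ * (y.im * D g), D y.re⟩ := rfl

theorem QuadraticAlgebra.derivationOmegaMul_algebraMap {K R : Type*} [Field K] [CharZero K]
    [CommRing R] [Algebra K R] (D : Derivation K R R) (g r : R) :
    derivationOmegaMul D g (algebraMap R _ r) = omega * algebraMap R _ (D r) := by
  rw [derivationOmegaMul_apply]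
  ext <;> simp

theorem QuadraticAlgebra.derivationOmegaMul_omega {K R : Type*} [Field K] [CharZero K]
    [CommRing R] [Algebra K R] (D : Derivation K R R) (g : R) :
    derivationOmegaMul D g omega = algebraMap R _ (algebraMap K R 2⁻¹ * D g) := by
  rw [derivationOmegaMul_apply]
  ext <;> simp

variable {K L : Type u} [Field K] [Field L] [Algebra K L]
  {V : ValuationSubring L} {s : L} {δ : Derivation K L L} {hV : IsPlaceAtInfinity V s δ}
  {R : Type u} [CommRing R] [Algebra K R] {x P : R} {D : Derivation K R R} {m : ℕ}

theorem IsModel.valuation_eq_sq (hM : IsModel hV x P D m) {g : R}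
    (hg : g - x ^ 2 ∈ poleOrderLE hV x 1) {E : Type u} [Field E] [Algebra K E]
    (W : ValuationSubring E) (hW : ∀ k : K, algebraMap K E k ∈ W) (f : R →ₐ[K] E)
    (hf : 1 < W.valuation (f x)) : W.valuation (f g) = W.valuation (f x) ^ 2 := by
  refine W.valuation.map_eq_sq_of_map_sub_le hf ?_
  have := hM.valuation_le W hW f hf 1 _ hg
  rwa [map_sub, map_pow, zpow_one] at this

/-- If `g = u²`, then `u` lies in no maximal ideal, so it is a unit. But `u` has a simple pole at
every place at infinity, so its inverse vanishes at all of them and must be zero. -/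
theorem IsModel.sq_ne (hM : IsModel hV x P D m) {g : R}
    (hg : g - x ^ 2 ∈ poleOrderLE hV x 1) (hg2 : ∀ M : Ideal R, M.IsMaximal → g ∉ M ^ 2) (u : R) :
    u ^ 2 ≠ g := by
  rintro rfl
  have := hM.isDedekindDomain
  have hu : IsUnit u := by
    by_contra hu
    obtain ⟨M, hM, huM⟩ := exists_max_ideal_of_mem_nonunits hu
    exact hg2 M hM (Ideal.pow_mem_pow huM 2)
  obtain ⟨w, hw⟩ := hu.exists_right_inv
  have hw0 : w = 0 := by
    refine hM.eq_zero (-1) (by norm_num) w fun τ hτ => ?_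
    have h1 := hM.valuation_eq_sq hg V hV.algebraMap_mem τ (by rw [hτ]; exact hV.one_lt)
    have h2 := V.valuation.map_eq_of_sq_eq (map_pow τ u 2).symm h1
    have h3 : V.valuation (τ u) * V.valuation (τ w) = 1 := by
      rw [← map_mul, ← map_mul, hw, map_one, map_one]
    rw [h2, hτ] at h3
    rw [zpow_neg_one, eq_inv_of_mul_eq_one_right h3]
  rw [hw0, mul_zero] at hw
  exact zero_ne_one hw

/-- The places of `R[√g]` above infinity. -/
theorem mem_poleOrderLE_quadraticAlgebra [CharZero K] {g : R}
    (hg : g - x ^ 2 ∈ poleOrderLE hV x 1) (y : QuadraticAlgebra R g 0) (d : ℤ) :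
    y ∈ poleOrderLE hV (algebraMap R (QuadraticAlgebra R g 0) x) d ↔
      y.re ∈ poleOrderLE hV x d ∧ y.im ∈ poleOrderLE hV x (d - 1) := by
  have hs0 : V.valuation s ≠ 0 := (V.valuation.ne_zero_iff).2 hV.ne_zero
  have hval : ∀ τ : R →ₐ[K] L, τ x = s → V.valuation (τ g - s ^ 2) ≤ V.valuation s := by
    intro τ hτ
    have := hg τ hτ
    rwa [map_sub, map_pow, hτ, zpow_one] at this
  have hzpow : V.valuation s ^ (d - 1) * V.valuation s = V.valuation s ^ d := by
    rw [← zpow_add_one₀ hs0, sub_add_cancel]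
  constructor
  · intro h
    have key : ∀ τ : R →ₐ[K] L, τ x = s → V.valuation (τ y.re) ≤ V.valuation s ^ d ∧
        V.valuation (τ y.im) ≤ V.valuation s ^ (d - 1) := by
      intro τ hτ
      obtain ⟨w, hw⟩ := hV.exists_sq_eq (τ g) (hval τ hτ)
      have hvw : V.valuation w = V.valuation s :=
        V.valuation.map_eq_of_sq_eq hw (V.valuation.map_eq_sq_of_map_sub_le hV.one_lt (hval τ hτ))
      -- Each place `τ` extends in two ways, `√g ↦ ± w`; half the sum and half the difference of the
      -- two values of `y` isolate `y.re` and `y.im * w`.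
      have lift : ∀ w : L, w ^ 2 = τ g → ∃ τ' : QuadraticAlgebra R g 0 →ₐ[K] L,
          τ' (algebraMap R _ x) = s ∧ τ' y = τ y.re + τ y.im * w := by
        intro w hw
        let _ : Algebra R L := τ.toRingHom.toAlgebra
        have halg : ∀ r, algebraMap R L r = τ r := fun _ => rfl
        have : IsScalarTower K R L := IsScalarTower.of_algebraMap_eq fun k => (τ.commutes k).symm
        let l : QuadraticAlgebra R g 0 →ₐ[R] L := QuadraticAlgebra.lift ⟨w, by
          rw [← pow_two, hw, Algebra.smul_def, zero_smul, halg, mul_one, add_zero]⟩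
        refine ⟨l.restrictScalars K, ?_, ?_⟩
        · rw [AlgHom.restrictScalars_apply, AlgHom.commutes, halg, hτ]
        · change y.re • (1 : L) + y.im • w = _
          rw [Algebra.smul_def, Algebra.smul_def, halg, halg, mul_one]
      obtain ⟨τ₁, h1, h1y⟩ := lift w hw
      obtain ⟨τ₂, h2, h2y⟩ := lift (-w) (by rw [neg_sq, hw])
      have hv1 := h τ₁ h1
      have hv2 := h τ₂ h2
      have h2K : V.valuation (algebraMap K L 2⁻¹) ≤ 1 :=
        (V.valuation_le_one_iff _).2 (hV.algebraMap_mem _)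
      have h22 : algebraMap K L 2⁻¹ * 2 = 1 := by
        rw [← map_ofNat (algebraMap K L) 2, ← map_mul, inv_mul_cancel₀ two_ne_zero, map_one]
      have hre : τ y.re = algebraMap K L 2⁻¹ * (τ₁ y + τ₂ y) := by
        rw [h1y, h2y]; linear_combination (- τ y.re) * h22
      have him : τ y.im * w = algebraMap K L 2⁻¹ * (τ₁ y - τ₂ y) := by
        rw [h1y, h2y]; linear_combination (- τ y.im * w) * h22
      have hb : ∀ z, V.valuation z ≤ V.valuation s ^ d →
          V.valuation (algebraMap K L 2⁻¹ * z) ≤ V.valuation s ^ d := by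
        intro z hz
        rw [map_mul]
        exact (mul_le_mul' h2K hz).trans_eq (one_mul _)
      constructor
      · rw [hre]
        exact hb _ ((V.valuation.map_add _ _).trans (max_le hv1 hv2))
      · have h3 := hb _ ((V.valuation.map_sub _ _).trans (max_le hv1 hv2))
        rw [← him, map_mul, hvw, ← hzpow] at h3
        exact (mul_le_mul_iff_left₀ (zero_lt_iff.2 hs0)).1 h3
    exact ⟨fun τ hτ => (key τ hτ).1, fun τ hτ => (key τ hτ).2⟩
  · rintro ⟨h1, h2⟩ τ hτ
    let τ' : R →ₐ[K] L := τ.comp (IsScalarTower.toAlgHom K R _)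
    have hτ' : τ' x = s := hτ
    have hvw : V.valuation (τ omega) = V.valuation s :=
      V.valuation.map_eq_of_sq_eq (g := τ' g) (by rw [← map_pow, omega_sq]; rfl)
        (V.valuation.map_eq_sq_of_map_sub_le hV.one_lt (hval τ' hτ'))
    rw [y.eq_algebraMap_add, map_add, map_mul]
    refine (V.valuation.map_add _ _).trans (max_le (h1 τ' hτ') ?_)
    rw [map_mul, hvw, ← hzpow]
    exact mul_le_mul_left (h2 τ' hτ') _

/-- Adjoining the square root of `g = x² + O(x)`, squarefree at all primes, to a model. -/
theorem IsModel.quadraticAlgebra [CharZero K] (hM : IsModel hV x P D m) {g : R}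
    (hg : g - x ^ 2 ∈ poleOrderLE hV x 1) (hg2 : ∀ M : Ideal R, M.IsMaximal → g ∉ M ^ 2) :
    IsModel hV (algebraMap R (QuadraticAlgebra R g 0) x)
      (algebraMap R (QuadraticAlgebra R g 0) P * omega) (derivationOmegaMul D g) (m + 1) := by
  have := hM.isDedekindDomain
  have := hM.finiteType
  have h2 : IsUnit (2 : R) := by
    have : IsUnit (algebraMap K R 2) := IsUnit.map _ (isUnit_iff_ne_zero.2 two_ne_zero)
    rwa [map_ofNat] at this
  have hsq := hM.sq_ne hg hg2
  have hdom := isDomain_of_forall_sq_ne hsq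
  have e (d : ℤ) : poleOrderLE hV (algebraMap R (QuadraticAlgebra R g 0) x) d ≃ₗ[K]
      poleOrderLE hV x d × poleOrderLE hV x (d - 1) :=
    { toFun := fun y => (⟨y.1.re, ((mem_poleOrderLE_quadraticAlgebra hg _ _).1 y.2).1⟩,
        ⟨y.1.im, ((mem_poleOrderLE_quadraticAlgebra hg _ _).1 y.2).2⟩)
      invFun := fun y => ⟨⟨y.1, y.2⟩,
        (mem_poleOrderLE_quadraticAlgebra hg _ _).2 ⟨y.1.2, y.2.2⟩⟩
      left_inv := fun y => rfl
      right_inv := fun y => rfl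
      map_add' := fun y w => rfl
      map_smul' := fun k y => rfl }
  have hsub {E : Type u} [Field E] [Algebra K E] (W : ValuationSubring E)
      (hW : ∀ k : K, algebraMap K E k ∈ W) (f : QuadraticAlgebra R g 0 →ₐ[K] E)
      (hf : 1 < W.valuation (f (algebraMap R _ x))) :
      W.valuation (f omega) = W.valuation (f (algebraMap R _ x)) := by
    refine W.valuation.map_eq_of_sq_eq (g := f (algebraMap R _ g))
      (by rw [← map_pow, omega_sq]) ?_
    exact hM.valuation_eq_sq hg W hW (f.comp (IsScalarTower.toAlgHom K R _)) hf
  exact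
  { finiteType := Algebra.FiniteType.trans hM.finiteType inferInstance
    isDedekindDomain := QuadraticAlgebra.isDedekindDomain h2 hsq hg2
    span_range := by
      by_contra hne
      obtain ⟨M, hMmax, hle⟩ := Ideal.exists_le_maximal _ hne
      have hmem : ∀ y, derivationOmegaMul D g y ∈ M := fun y => hle (Ideal.subset_span ⟨y, rfl⟩)
      have hω : (omega : QuadraticAlgebra R g 0) ∈ M := by
        -- The new derivation sends `r ∈ R` to `√g D r`, and the values `D r` generate the unit
        -- ideal, so `√g ∈ M`.
        have h1 : Ideal.span (Set.range D) ≤ Submodule.comap (LinearMap.toSpanSingleton R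
            (QuadraticAlgebra R g 0) omega) (M.restrictScalars R) := by
          refine Ideal.span_le.2 ?_
          rintro _ ⟨r, rfl⟩
          have := hmem (algebraMap R _ r)
          rw [derivationOmegaMul_algebraMap] at this
          simpa [Algebra.smul_def, mul_comm] using this
        rw [hM.span_range] at h1
        simpa using h1 (Submodule.mem_top (x := (1 : R)))
      have hMc : (M.comap (algebraMap R (QuadraticAlgebra R g 0))).IsMaximal :=
        Ideal.isMaximal_comap_of_isIntegral_of_isMaximal M
      have hgM : g ∈ M.comap (algebraMap R (QuadraticAlgebra R g 0)) := by
        rw [Ideal.mem_comap, ← omega_sq]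
        exact Ideal.pow_mem_of_mem M hω 2 two_pos
      have hDg : D g ∈ M.comap (algebraMap R (QuadraticAlgebra R g 0)) := by
        have h1 := hmem omega
        rw [derivationOmegaMul_omega, ← Ideal.mem_comap] at h1
        have h2 := Ideal.mul_mem_left _ (algebraMap K R 2) h1
        rwa [← mul_assoc, ← map_mul, mul_inv_cancel₀ two_ne_zero, map_one, one_mul] at h2
      -- Both `g` and `D g` lie in `M ∩ R`, so `g` would lie in the square of this maximal ideal.
      exact hg2 _ hMc (D.mem_sq_of_mem_of_apply_mem hM.span_range _ hgM hDg)
    apply_x := by rw [derivationOmegaMul_algebraMap, hM.apply_x, mul_comm]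
    ne_zero := by
      refine mul_ne_zero ?_ fun h => ?_
      · rw [Ne, FaithfulSMul.algebraMap_eq_zero_iff]
        exact hM.ne_zero
      · simpa using congrArg QuadraticAlgebra.im h
    deriv_eq := by
      intro A M _ _ _ _ _ f d y
      have hd (r : R) : f (algebraMap R _ P) • d (f (algebraMap R _ r)) =
          f (algebraMap R _ (D r)) • d (f (algebraMap R _ x)) :=
        hM.deriv_eq (f.comp (IsScalarTower.toAlgHom K R _)) d r
      have h4 : f omega * f omega = f (algebraMap R _ g) := by
        rw [← map_mul, ← pow_two, omega_sq]
      have h5 : f (algebraMap R _ (algebraMap K R 2⁻¹)) * 2 = 1 := by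
        rw [← map_ofNat (f.toRingHom) 2, ← map_ofNat (algebraMap R (QuadraticAlgebra R g 0)) 2,
          ← map_ofNat (algebraMap K R) 2]
        change f _ * f _ = 1
        rw [← map_mul, ← map_mul, ← map_mul, inv_mul_cancel₀ two_ne_zero, map_one, map_one, map_one]
      have h3 : f omega • d (f omega) + f omega • d (f omega) = d (f (algebraMap R _ g)) := by
        rw [← h4, Derivation.leibniz]
      have hy : d (f y) = d (f (algebraMap R _ y.re)) + (f (algebraMap R _ y.im) • d (f omega) +
          f omega • d (f (algebraMap R _ y.im))) := by
        conv_lhs => rw [y.eq_algebraMap_add, map_add, map_mul, map_add, Derivation.leibniz]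
      have hDy : f (derivationOmegaMul D g y) = f (algebraMap R _ g) * f (algebraMap R _ (D y.im)) +
          f (algebraMap R _ (algebraMap K R 2⁻¹)) *
            (f (algebraMap R _ y.im) * f (algebraMap R _ (D g))) +
          f (algebraMap R _ (D y.re)) * f omega := by
        conv_lhs => rw [(derivationOmegaMul D g y).eq_algebraMap_add]
        simp only [derivationOmegaMul_apply, map_add, map_mul]
      rw [hy, hDy, map_mul]
      -- The terms use `P du = (D u) dx` for `u = y.re, y.im, g`, then `2 √g d√g = dg` to eliminate
      -- `dg`.
      linear_combination (norm := module) f omega • hd y.re + (f omega * f omega) • hd y.im +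
        (f (algebraMap R _ (algebraMap K R 2⁻¹)) * f (algebraMap R _ y.im)) • hd g +
        (f (algebraMap R _ (algebraMap K R 2⁻¹)) * f (algebraMap R _ y.im) *
          f (algebraMap R _ P)) • h3 +
        h4 • (f (algebraMap R _ (D y.im)) • d (f (algebraMap R _ x))) -
        h5 • ((f (algebraMap R _ P) * f omega * f (algebraMap R _ y.im)) • d (f omega))
    injective := by
      intro τ hτ
      refine (injective_iff_map_eq_zero _).2 fun y hy => eq_zero_of_norm_eq_zero hsq ?_
      refine hM.injective (τ.comp (IsScalarTower.toAlgHom K R _)) hτ ?_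
      rw [map_zero]
      change τ (algebraMap R _ _) = 0
      rw [algebraMap_norm_eq_mul_star, map_mul, hy, zero_mul]
    eq_zero := by
      intro d hd y hy
      rw [mem_poleOrderLE_quadraticAlgebra hg] at hy
      exact QuadraticAlgebra.ext (hM.eq_zero d hd _ hy.1) (hM.eq_zero (d - 1) (by omega) _ hy.2)
    finite := by
      intro d
      have := hM.finite d
      have := hM.finite (d - 1)
      exact Module.Finite.equiv (e d).symm
    finrank := by
      intro d
      have := hM.finite d
      have := hM.finite (d - 1)
      rw [(e d).finrank_eq, Module.finrank_prod, hM.finrank, hM.finrank, poleDim]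
    apply_mem := by
      intro E _ _ W hW f hf y
      have h1 := hM.apply_mem W hW (f.comp (IsScalarTower.toAlgHom K R _)) hf
      have hω : f omega ∈ W := by
        have h2 := h1 g
        rw [← W.valuation_le_one_iff] at h2 ⊢
        have h3 : f (algebraMap R _ g) = f omega ^ 2 := by rw [← map_pow, omega_sq]
        change W.valuation (f (algebraMap R _ g)) ≤ 1 at h2
        rw [h3, map_pow] at h2
        exact (pow_le_one_iff two_ne_zero).1 h2
      rw [y.eq_algebraMap_add, map_add, map_mul]
      exact add_mem (h1 _) (mul_mem (h1 _) hω)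
    valuation_le := by
      intro E _ _ W hW f hf d y hy
      rw [mem_poleOrderLE_quadraticAlgebra hg] at hy
      have h1 := hM.valuation_le W hW (f.comp (IsScalarTower.toAlgHom K R _)) hf
      have hs0 : W.valuation (f (algebraMap R _ x)) ≠ 0 := (zero_lt_one.trans hf).ne'
      rw [y.eq_algebraMap_add, map_add, map_mul]
      refine (W.valuation.map_add _ _).trans (max_le (h1 _ _ hy.1) ?_)
      rw [map_mul, hsub W hW f hf]
      refine (mul_le_mul_left (h1 _ _ hy.2) _).trans_eq ?_
      change W.valuation (f (algebraMap R _ x)) ^ (d - 1) * _ = _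
      rw [← zpow_add_one₀ hs0, sub_add_cancel]
    valuation_eq := by
      intro E _ _ W hW f hf
      have h1 := hM.valuation_eq W hW (f.comp (IsScalarTower.toAlgHom K R _)) hf
      rw [map_mul, map_mul, hsub W hW f hf, pow_succ]
      exact congrArg (· * _) h1 }

end Step

/-! ### Regular differentials and the genus -/

section Genus

variable {K L : Type u} [Field K] [Field L] [Algebra K L]
  {V : ValuationSubring L} {s : L} {δ : Derivation K L L} {hV : IsPlaceAtInfinity V s δ}
  {R : Type u} [CommRing R] [Algebra K R] {x P : R} {D : Derivation K R R} {m : ℕ}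
  (F : Type u) [Field F] [Algebra K F] [Algebra R F] [IsScalarTower K R F] [IsFractionRing R F]

/-- The invariant differential `dx / P` generates the differentials of the function field. -/
theorem IsModel.exists_linearMap (hM : IsModel hV x P D m) :
    ∃ l : Ω[F⁄K] →ₗ[F] F,
      (∀ r : R, l (KaehlerDifferential.D K F (algebraMap R F r)) = algebraMap R F (D r)) ∧
      ∀ ω : Ω[F⁄K], ω = l ω • (algebraMap R F P)⁻¹ • KaehlerDifferential.D K F (algebraMap R F x) := by
  have := hM.isDedekindDomain
  obtain ⟨l, hl⟩ := exists_linearMap_kaehlerDifferential_fractionRing (F := F) D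
  have hP : algebraMap R F P ≠ 0 := by
    rw [Ne, FaithfulSMul.algebraMap_eq_zero_iff]; exact hM.ne_zero
  refine ⟨l, hl, fun ω => ?_⟩
  have h1 : (LinearMap.id : Ω[F⁄K] →ₗ[F] Ω[F⁄K]) = l.smulRight
      ((algebraMap R F P)⁻¹ • KaehlerDifferential.D K F (algebraMap R F x)) := by
    refine LinearMap.ext_on
      (KaehlerDifferential.span_range_map_derivation_of_isLocalization K R F (nonZeroDivisors R)) ?_
    rintro _ ⟨r, rfl⟩
    have h2 := hM.deriv_eq (IsScalarTower.toAlgHom K R F) (KaehlerDifferential.D K F) r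
    simp only [IsScalarTower.coe_toAlgHom'] at h2
    simp only [Function.comp_apply, KaehlerDifferential.map_D, LinearMap.id_apply,
      LinearMap.smulRight_apply, hl]
    rw [smul_comm, ← h2, inv_smul_smul₀ hP]
  exact LinearMap.congr_fun h1 ω

omit [IsScalarTower K R F] [IsFractionRing R F] in
/-- If the valuation ring `W` contains the ring `R`, all of whose local rings are regular, then
`dx / P` is regular at `W`. -/
theorem IsModel.smul_mem_span (hM : IsModel hV x P D m) {l : Ω[F⁄K] →ₗ[F] F}
    (hl : ∀ r : R, l (KaehlerDifferential.D K F (algebraMap R F r)) = algebraMap R F (D r))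
    {ω₀ : Ω[F⁄K]} (hω : ∀ ω : Ω[F⁄K], ω = l ω • ω₀) (W : ValuationSubring F)
    (hW : ∀ r : R, algebraMap R F r ∈ W) (h : R) : algebraMap R F h • ω₀ ∈
      Submodule.span W.toSubring ((fun y : F => KaehlerDifferential.D K F y) '' (W : Set F)) := by
  -- The multiples `(D r) dx / P = dr` are regular at `W`, and the `D r` generate the unit ideal.
  have key : ∀ h ∈ Ideal.span (Set.range D), algebraMap R F h • ω₀ ∈
      Submodule.span W.toSubring
        ((fun y : F => KaehlerDifferential.D K F y) '' (W : Set F)) := by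
    intro h hh
    refine Submodule.span_induction ?_ ?_ ?_ ?_ hh
    · rintro _ ⟨r, rfl⟩
      rw [← hl, ← hω]
      exact Submodule.subset_span ⟨_, hW r, rfl⟩
    · rw [map_zero, zero_smul]; exact zero_mem _
    · intro a b _ _ ha hb
      rw [map_add, add_smul]; exact add_mem ha hb
    · intro a b _ hb
      rw [smul_eq_mul, map_mul, mul_smul]
      exact Submodule.smul_mem _ (⟨algebraMap R F a, hW a⟩ : W.toSubring) hb
  exact key h (by rw [hM.span_range]; exact Submodule.mem_top)

/-- A differential that is regular at all places of the affine curve is a multiple of `dx / P` by a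
regular function. -/
theorem IsModel.mem_range_of_mem_regularDifferentials (hM : IsModel hV x P D m) {l : Ω[F⁄K] →ₗ[F] F}
    (hl : ∀ r : R, l (KaehlerDifferential.D K F (algebraMap R F r)) = algebraMap R F (D r))
    {ω : Ω[F⁄K]} (hω : ω ∈ regularDifferentials K F) : l ω ∈ (algebraMap R F).range := by
  have := hM.isDedekindDomain
  refine IsDedekindDomain.HeightOneSpectrum.mem_integers_of_valuation_le_one F _ fun v => ?_
  have hR : ∀ r : R, algebraMap R F r ∈ (v.valuation F).valuationSubring :=
    fun r => v.valuation_le_one r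
  have h1 := hω (v.valuation F).valuationSubring fun k => by
    rw [IsScalarTower.algebraMap_apply K R F]; exact hR _
  change l ω ∈ (v.valuation F).valuationSubring
  refine Submodule.span_induction (p := fun ω _ => l ω ∈ (v.valuation F).valuationSubring)
    ?_ ?_ ?_ ?_ h1
  · rintro _ ⟨y, hy, rfl⟩
    -- Writing `t y = n` with `t` a unit at `v`, the Leibniz rule gives `t l(dy) = D n - y D t`,
    -- which is integral at `v`.
    obtain ⟨n, t, ht⟩ := v.exists_primeCompl_mul_eq_of_integer y hy
    have ht1 : v.valuation F (algebraMap R F t) = 1 := by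
      rw [v.valuation_eq_one_iff_notMem]; exact t.2
    have h2 := congrArg (fun z => l (KaehlerDifferential.D K F z)) ht
    simp only [Derivation.leibniz, map_add, map_smul, hl, smul_eq_mul] at h2
    have h3 : algebraMap R F t * l (KaehlerDifferential.D K F y) =
        algebraMap R F (D n) - y * algebraMap R F (D t) := by
      rw [← h2]; ring
    have h4 : algebraMap R F t * l (KaehlerDifferential.D K F y) ∈
        (v.valuation F).valuationSubring := by
      rw [h3]; exact sub_mem (hR _) (mul_mem hy (hR _))
    rw [Valuation.mem_valuationSubring_iff, map_mul, ht1, one_mul] at h4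
    exact h4
  · rw [map_zero]; exact zero_mem _
  · intro a b _ _ ha hb
    rw [map_add]; exact add_mem ha hb
  · intro c b _ hb
    have : l (c • b) = c.1 * l b := by
      rw [← smul_eq_mul, ← map_smul]; rfl
    rw [this]
    exact mul_mem c.2 hb

/-- A differential `h dx / P` that is regular at the places at infinity is such that `h` has poles
of order at most `m - 2` there. -/
theorem IsModel.mem_poleOrderLE_of_mem_regularDifferentials (hM : IsModel hV x P D m)
    {l : Ω[F⁄K] →ₗ[F] F}
    (hl : ∀ r : R, l (KaehlerDifferential.D K F (algebraMap R F r)) = algebraMap R F (D r))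
    {ω : Ω[F⁄K]} (hω : ω ∈ regularDifferentials K F) {h : R} (hh : algebraMap R F h = l ω) :
    h ∈ poleOrderLE hV x (m - 2) := by
  have := hM.isDedekindDomain
  intro τ hτ
  have hinj := hM.injective τ hτ
  let τF : F →ₐ[K] L := IsFractionRing.liftAlgHom (K := F) hinj
  have hτF : ∀ r, τF (algebraMap R F r) = τ r := fun r => 
    IsFractionRing.lift_algebraMap (g := τ.toRingHom) hinj r
  have hs1 : 1 < V.valuation (τ x) := by rw [hτ]; exact hV.one_lt
  have hs0 : V.valuation s ≠ 0 := (zero_lt_one.trans hV.one_lt).ne'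
  have hvP : V.valuation (τ P) = V.valuation s ^ m := by
    rw [← hτ]; exact hM.valuation_eq V hV.algebraMap_mem τ hs1
  -- The chain rule for `x ↦ s`: `D` is `P d/dx`, while `δ s = -s²`.
  have hder : ∀ r : R, τ P * δ (τ r) = - (τ (D r) * s ^ 2) := fun r => by
    have := hM.deriv_eq τ δ r
    rw [hτ, hV.derivation_apply, smul_eq_mul, smul_eq_mul] at this
    rw [this]; ring
  have hderF : ∀ y : F, τ P * δ (τF y) = - (τF (l (KaehlerDifferential.D K F y)) * s ^ 2) := by
    intro y
    obtain ⟨n, t, ht, rfl⟩ := IsFractionRing.div_surjective (A := R) y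
    set y := algebraMap R F n / algebraMap R F t
    have ht0 : algebraMap R F t ≠ 0 := by
      simpa using nonZeroDivisors.ne_zero ht
    have hy : y * algebraMap R F t = algebraMap R F n := div_mul_cancel₀ _ ht0
    have h1 := congrArg (fun z => τF (l (KaehlerDifferential.D K F z))) hy
    have h2 := congrArg (fun z => δ (τF z)) hy
    simp only [Derivation.leibniz, map_add, map_smul, map_mul, hl, hτF, smul_eq_mul] at h1 h2
    have h3 : τ t ≠ 0 := by
      rw [← hτF]; exact (map_ne_zero τF).2 ht0
    refine mul_left_cancel₀ h3 ?_
    have e1 := hder n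
    have e2 := hder t
    linear_combination τ P * h2 + e1 + s ^ 2 * h1 - τF y * e2
  have h1 := hω (V.comap (τF : F →+* L)) fun k => by
    rw [ValuationSubring.mem_comap]
    change τF (algebraMap K F k) ∈ V
    rw [AlgHom.commutes]
    exact hV.algebraMap_mem k
  have h2 : V.valuation (τF (l ω)) ≤ V.valuation s ^ ((m : ℤ) - 2) := by
    refine Submodule.span_induction
      (p := fun ω _ => V.valuation (τF (l ω)) ≤ V.valuation s ^ ((m : ℤ) - 2)) ?_ ?_ ?_ ?_ h1
    · rintro _ ⟨y, hy, rfl⟩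
      have h3 := congrArg V.valuation (hderF y)
      rw [map_mul, Valuation.map_neg, map_mul, map_pow, hvP] at h3
      have h4 : V.valuation (δ (τF y)) ≤ 1 :=
        (V.valuation_le_one_iff _).2 (hV.derivation_mem _ hy)
      -- From `P δ(y) = -l(dy) s²`: a pole of order `m` from `P`, reduced by two through `s²`.
      have h5 : V.valuation (τF (l (KaehlerDifferential.D K F y))) =
          V.valuation s ^ ((m : ℤ) - 2) * V.valuation (δ (τF y)) := by
        rw [zpow_sub₀ hs0, zpow_natCast, div_mul_eq_mul_div, h3]
        exact (mul_div_cancel_right₀ _ (zpow_ne_zero 2 hs0)).symm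
      change V.valuation (τF (l (KaehlerDifferential.D K F y))) ≤ _
      rw [h5]
      exact (mul_le_mul_right h4 _).trans_eq (mul_one _)
    · rw [map_zero, map_zero, map_zero]; exact zero_le
    · intro a b _ _ ha hb
      rw [map_add, map_add]
      exact (V.valuation.map_add _ _).trans (max_le ha hb)
    · intro c b _ hb
      have h3 : l (c • b) = c.1 * l b := by
        rw [← smul_eq_mul, ← map_smul]; rfl
      have h4 : V.valuation (τF c.1) ≤ 1 := (V.valuation_le_one_iff _).2 c.2
      rw [h3, map_mul, map_mul]
      exact (mul_le_mul' h4 hb).trans_eq (one_mul _)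
  rw [← hh, hτF] at h2
  exact h2

omit [IsFractionRing R F] in
/-- The differentials `h dx / P` are regular at infinity if `h` has poles of order at most `m - 2`
there. -/
theorem IsModel.smul_mem_span_of_one_lt (hM : IsModel hV x P D m) (W : ValuationSubring F)
    (hW : ∀ k : K, algebraMap K F k ∈ W) (hx : 1 < W.valuation (algebraMap R F x))
    {h : R} (hh : h ∈ poleOrderLE hV x (m - 2)) :
    algebraMap R F h • (algebraMap R F P)⁻¹ • KaehlerDifferential.D K F (algebraMap R F x) ∈
      Submodule.span W.toSubring ((fun y : F => KaehlerDifferential.D K F y) '' (W : Set F)) := by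
  set X := algebraMap R F x
  have hX0 : X ≠ 0 := by
    intro h0; rw [h0, map_zero] at hx; exact absurd hx (by simp)
  have hv0 : W.valuation X ≠ 0 := (zero_lt_one.trans hx).ne'
  have hP : W.valuation (algebraMap R F P) = W.valuation X ^ m :=
    hM.valuation_eq W hW (IsScalarTower.toAlgHom K R F) hx
  have hh' : W.valuation (algebraMap R F h) ≤ W.valuation X ^ ((m : ℤ) - 2) :=
    hM.valuation_le W hW (IsScalarTower.toAlgHom K R F) hx _ h hh
  have hinv : X⁻¹ ∈ W := by
    rw [← W.valuation_le_one_iff, map_inv₀]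
    exact inv_le_one_of_one_le₀ hx.le
  -- The coefficient of `h dx / P` when written with `d(x⁻¹)`, by `dx = -x² d(x⁻¹)`; its pole order
  -- is at most `(m - 2) - m + 2 = 0`.
  have hc : - (algebraMap R F h * (algebraMap R F P)⁻¹ * X ^ 2) ∈ W := by
    refine neg_mem ?_
    rw [← W.valuation_le_one_iff, map_mul, map_mul, map_inv₀, map_pow, hP]
    calc _ ≤ W.valuation X ^ ((m : ℤ) - 2) * (W.valuation X ^ m)⁻¹ * W.valuation X ^ 2 := by
          gcongr
      _ = 1 := by
          rw [zpow_sub₀ hv0, zpow_natCast]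
          have : (W.valuation X ^ (2 : ℤ)) = W.valuation X ^ 2 := zpow_ofNat _ 2
          rw [this]
          field_simp
  have heq : algebraMap R F h • (algebraMap R F P)⁻¹ • KaehlerDifferential.D K F X =
      (⟨_, hc⟩ : W.toSubring) • KaehlerDifferential.D K F X⁻¹ := by
    change _ = (- (algebraMap R F h * (algebraMap R F P)⁻¹ * X ^ 2)) • KaehlerDifferential.D K F X⁻¹
    rw [Derivation.leibniz_inv, smul_smul, smul_smul]
    congr 1
    field_simp
  rw [heq]
  exact Submodule.smul_mem _ _ (Submodule.subset_span ⟨_, hinv, rfl⟩)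

/-- The isomorphism is `h ↦ h dx / P`. A valuation ring over `K` either contains `x`, hence all of
`R`, or has `x` with a pole; these two cases are the affine and the infinite places. -/
theorem IsModel.finite_and_finrank_regularDifferentials (hM : IsModel hV x P D m) :
    Module.Finite K (regularDifferentials K F) ∧
      Module.finrank K (regularDifferentials K F) = poleDim m (m - 2) := by
  have := hM.isDedekindDomain
  obtain ⟨l, hl, hω⟩ := hM.exists_linearMap F
  set ω₀ := (algebraMap R F P)⁻¹ • KaehlerDifferential.D K F (algebraMap R F x)
  have hP : algebraMap R F P ≠ 0 := by
    rw [Ne, FaithfulSMul.algebraMap_eq_zero_iff]; exact hM.ne_zero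
  have hl0 : l ω₀ = 1 := by
    rw [map_smul, hl, hM.apply_x, smul_eq_mul, inv_mul_cancel₀ hP]
  let Θ : R →ₗ[K] Ω[F⁄K] :=
    { toFun := fun h => algebraMap R F h • ω₀
      map_add' := fun a b => by rw [map_add, add_smul]
      map_smul' := fun k a => by
        rw [Algebra.smul_def, map_mul, mul_smul, ← IsScalarTower.algebraMap_apply,
          algebraMap_smul, RingHom.id_apply] }
  have hΘ : Function.Injective Θ := by
    intro a b hab
    have h1 := congrArg l hab
    change l (algebraMap R F a • ω₀) = l (algebraMap R F b • ω₀) at h1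
    rw [l.map_smul _ ω₀, l.map_smul _ ω₀, hl0, smul_eq_mul, smul_eq_mul, mul_one, mul_one] at h1
    exact IsFractionRing.injective R F h1
  have hrange : regularDifferentials K F = (poleOrderLE hV x ((m : ℤ) - 2)).map Θ := by
    ext ω
    constructor
    · intro h
      obtain ⟨r, hr⟩ := hM.mem_range_of_mem_regularDifferentials F hl h
      refine ⟨r, hM.mem_poleOrderLE_of_mem_regularDifferentials F hl h hr, ?_⟩
      change algebraMap R F r • ω₀ = ω
      rw [hr, ← hω]
    · rintro ⟨h, hh, rfl⟩ W hW
      by_cases hx : algebraMap R F x ∈ W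
      · exact hM.smul_mem_span F hl hω W
          (hM.apply_mem W hW (IsScalarTower.toAlgHom K R F) hx) h
      · rw [← W.valuation_le_one_iff, not_le] at hx
        exact hM.smul_mem_span_of_one_lt F W hW hx hh
  have := hM.finite ((m : ℤ) - 2)
  rw [hrange]
  exact ⟨inferInstance, by
    rw [← hM.finrank]
    exact (Submodule.equivMapOfInjective Θ hΘ _).finrank_eq.symm⟩

/-- The Riemann–Roch count `2^m d + 1 - g` in the range where no correction term occurs; `m - 1` is
the first such `d`. Doubling avoids a half at `m = 0`. -/
theorem poleDim_of_le (m : ℕ) : ∀ d : ℤ, (m : ℤ) - 1 ≤ d →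
    (2 * poleDim m d : ℤ) = 2 ^ m * (2 * d + 2 - m) := by
  induction m with
  | zero => intro d hd; simp [poleDim] at hd ⊢; omega
  | succ m ih =>
    intro d hd
    push_cast at hd
    rw [poleDim]
    push_cast
    rw [mul_add, ih d (by omega), ih (d - 1) (by omega)]
    ring

/-- The value `m - 2` is just below the range of `poleDim_of_le`. One step of the recursion splits
it into a value at the edge of that range and the same quantity for the previous `m`. -/
theorem poleDim_sub_two (m : ℕ) :
    (poleDim m ((m : ℤ) - 2) : ℚ) = ((m : ℚ) - 2) * 2 ^ ((m : ℤ) - 1) + 1 := by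
  induction m with
  | zero => simp [poleDim]
  | succ m ih =>
    have h1 := poleDim_of_le m ((m : ℤ) - 1) le_rfl
    have h2 : (2 * poleDim m ((m : ℤ) - 1) : ℚ) = 2 ^ m * (2 * ((m : ℚ) - 1) + 2 - m) := by
      exact_mod_cast h1
    rw [poleDim]
    push_cast
    rw [show (m : ℤ) + 1 - 2 - 1 = m - 2 by ring, show (m : ℤ) + 1 - 2 = m - 1 by ring, ih,
      show (m : ℤ) + 1 - 1 = m by ring, zpow_sub_one₀ two_ne_zero, zpow_natCast]
    linear_combination h2 / 2

end Genus

/-! ### The affine cone, its quadrics, and the kernels whose heights are compared -/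

section Tower

open MvPolynomial

variable {K : Type*} [Field K]

/-- The variable `Z_i` of `K[Z_0, …, Z_{M-1}]`, zero if `M ≤ i`. -/
noncomputable def varOrZero (K : Type*) [Field K] (M i : ℕ) : MvPolynomial (Fin M) K :=
  if h : i < M then X ⟨i, h⟩ else 0

/-- The quadric `Z_{k+1}² = Z_1² + ε_k Z_0 Z_{j(k)+1} - a Z_0²`, the homogenization of
`z_k² = z_0² + ε_k z_{j(k)} - a`. -/
noncomputable def towerQuadric (a : K) (ε : ℕ → K) (j : ℕ → ℕ) (M k : ℕ) :
    MvPolynomial (Fin M) K :=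
  varOrZero K M (k + 1) ^ 2 - varOrZero K M 1 ^ 2 -
    C (ε k) * (varOrZero K M 0 * varOrZero K M (j k + 1)) + C a * varOrZero K M 0 ^ 2

theorem isHomogeneous_varOrZero (M i : ℕ) : (varOrZero K M i).IsHomogeneous 1 := by
  unfold varOrZero
  split_ifs
  · exact isHomogeneous_X _ _
  · exact isHomogeneous_zero _ _ _

theorem isHomogeneous_towerQuadric (a : K) (ε : ℕ → K) (j : ℕ → ℕ) (M k : ℕ) :
    (towerQuadric a ε j M k).IsHomogeneous 2 := by
  have h (i : ℕ) : (varOrZero K M i ^ 2).IsHomogeneous 2 := by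
    simpa using (isHomogeneous_varOrZero M i).pow 2
  have h' (i l : ℕ) : (varOrZero K M i * varOrZero K M l).IsHomogeneous 2 :=
    (isHomogeneous_varOrZero M i).mul (isHomogeneous_varOrZero M l)
  have hC (c : K) {p : MvPolynomial (Fin M) K} (hp : p.IsHomogeneous 2) :
      (C c * p).IsHomogeneous 2 := by
    simpa using (isHomogeneous_C _ c).mul hp
  exact (((h _).sub (h _)).sub (hC _ (h' _ _))).add (hC _ (h _))

theorem rename_castSucc_varOrZero {M i : ℕ} (h : i < M) :
    rename Fin.castSucc (varOrZero K M i) = varOrZero K (M + 1) i := by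
  rw [varOrZero, varOrZero, dif_pos h, dif_pos (by omega), rename_X]
  rfl

theorem rename_castSucc_towerQuadric (a : K) (ε : ℕ → K) {j : ℕ → ℕ} {M k : ℕ} (hj : j k < k)
    (h : k + 1 < M) : rename Fin.castSucc (towerQuadric a ε j M k) =
      towerQuadric a ε j (M + 1) k := by
  unfold towerQuadric
  simp only [map_add, map_sub, map_mul, map_pow, algHom_C, algebraMap_eq]
  rw [rename_castSucc_varOrZero h, rename_castSucc_varOrZero (by omega),
    rename_castSucc_varOrZero (by omega), rename_castSucc_varOrZero (by omega)]

variable {R : Type*} [CommRing R] [Algebra K R]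

/-- The coordinates of the affine cone over the projective closure of the curve with
coordinates `z`. -/
noncomputable def coneCoord (z : ℕ → R) : ℕ → Polynomial R
  | 0 => Polynomial.X
  | k + 1 => Polynomial.C (z k) * Polynomial.X

/-- The restriction of polynomials to the affine cone. -/
noncomputable def coneHom (K : Type*) [Field K] [Algebra K R] (M : ℕ) (z : ℕ → R) :
    MvPolynomial (Fin M) K →ₐ[K] Polynomial R :=
  aeval fun i => coneCoord z i

/-- The restriction of polynomials to the cylinder over the affine cone of dimension two with
coordinates `Z_0, …, Z_{m+1}`. -/
noncomputable def cylinderHom (K : Type*) [Field K] [Algebra K R] (m M : ℕ) (z : ℕ → R) :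
    MvPolynomial (Fin M) K →ₐ[K] MvPolynomial (Fin M) (Polynomial R) :=
  aeval fun i => if (i : ℕ) ≤ m + 1 then C (coneCoord z i) else X i

theorem coneHom_varOrZero (z : ℕ → R) {M i : ℕ} (h : i < M) :
    coneHom K M z (varOrZero K M i) = coneCoord z i := by
  rw [varOrZero, dif_pos h, coneHom, aeval_X]

theorem cylinderHom_varOrZero (z : ℕ → R) {m M i : ℕ} (h : i < M) (hi : i ≤ m + 1) :
    cylinderHom K m M z (varOrZero K M i) = C (coneCoord z i) := by
  rw [varOrZero, dif_pos h, cylinderHom, aeval_X, if_pos hi]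

/-- For `M = m + 2` the cylinder has no free direction left and is the cone itself. -/
theorem cylinderHom_eq_zero_iff (z : ℕ → R) {m : ℕ} (F : MvPolynomial (Fin (m + 2)) K) :
    cylinderHom K m (m + 2) z F = 0 ↔ coneHom K (m + 2) z F = 0 := by
  have : (cylinderHom K m (m + 2) z) =
      (IsScalarTower.toAlgHom K (Polynomial R) (MvPolynomial (Fin (m + 2)) (Polynomial R))).comp
        (coneHom K (m + 2) z) := by
    refine algHom_ext fun i => ?_
    simp only [cylinderHom, coneHom, aeval_X, AlgHom.comp_apply, IsScalarTower.coe_toAlgHom',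
      algebraMap_eq]
    rw [if_pos (by omega)]
  rw [this, AlgHom.comp_apply, IsScalarTower.coe_toAlgHom', algebraMap_eq,
    map_eq_zero_iff _ (C_injective _ _)]

theorem towerQuadric_cone_eq_zero {a : K} {ε : ℕ → K} {j : ℕ → ℕ} {z : ℕ → R} {k : ℕ}
    (h : z k ^ 2 = z 0 ^ 2 + algebraMap K R (ε k) * z (j k) - algebraMap K R a) :
    coneCoord z (k + 1) ^ 2 - coneCoord z 1 ^ 2 - Polynomial.C (algebraMap K R (ε k)) *
      (coneCoord z 0 * coneCoord z (j k + 1)) +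
      Polynomial.C (algebraMap K R a) * coneCoord z 0 ^ 2 = 0 := by
  have h' := congrArg Polynomial.C h
  simp only [map_add, map_sub, map_mul, map_pow] at h'
  simp only [coneCoord]
  linear_combination Polynomial.X ^ 2 * h'

theorem coneHom_towerQuadric {a : K} {ε : ℕ → K} {j : ℕ → ℕ} {z : ℕ → R} {k M : ℕ}
    (h : z k ^ 2 = z 0 ^ 2 + algebraMap K R (ε k) * z (j k) - algebraMap K R a)
    (hj : j k < k) (hM : k + 1 < M) : coneHom K M z (towerQuadric a ε j M k) = 0 := by
  have h1 := towerQuadric_cone_eq_zero h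
  unfold towerQuadric
  simp only [map_add, map_sub, map_mul, map_pow]
  rw [coneHom_varOrZero z hM, coneHom_varOrZero z (by omega), coneHom_varOrZero z (by omega),
    coneHom_varOrZero z (by omega), algHom_C, algHom_C]
  exact h1

theorem cylinderHom_towerQuadric {a : K} {ε : ℕ → K} {j : ℕ → ℕ} {z : ℕ → R} {k m M : ℕ}
    (h : z k ^ 2 = z 0 ^ 2 + algebraMap K R (ε k) * z (j k) - algebraMap K R a)
    (hj : j k < k) (hM : k + 1 < M) (hm : k ≤ m) :
    cylinderHom K m M z (towerQuadric a ε j M k) = 0 := by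
  have h1 := congrArg (C (σ := Fin M)) (towerQuadric_cone_eq_zero h)
  simp only [map_add, map_sub, map_mul, map_pow, map_zero] at h1
  unfold towerQuadric
  simp only [map_add, map_sub, map_mul, map_pow]
  rw [cylinderHom_varOrZero z hM (by omega), cylinderHom_varOrZero z (by omega) (by omega),
    cylinderHom_varOrZero z (by omega) (by omega), cylinderHom_varOrZero z (by omega) (by omega),
    algHom_C, algHom_C]
  exact h1

/-- At stage `m` the variable `Z_{m+2}` is still free, and the next quadric is monic in it. This
makes the chain of primes strict. -/
theorem cylinderHom_towerQuadric_succ_ne_zero [Nontrivial R] {a : K} {ε : ℕ → K} {j : ℕ → ℕ}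
    {z : ℕ → R} {m M : ℕ} (hj : j (m + 1) < m + 1) (hM : m + 2 < M) :
    cylinderHom K m M z (towerQuadric a ε j M (m + 1)) ≠ 0 := by
  intro h
  unfold towerQuadric at h
  simp only [map_add, map_sub, map_mul, map_pow] at h
  rw [cylinderHom_varOrZero z (i := 1) (by omega) (by omega),
    cylinderHom_varOrZero z (i := 0) (by omega) (by omega),
    cylinderHom_varOrZero z (i := j (m + 1) + 1) (by omega) (by omega),
    algHom_C, algHom_C] at h
  have hX : cylinderHom K m M z (varOrZero K M (m + 1 + 1)) = X ⟨m + 2, hM⟩ := by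
    rw [varOrZero, dif_pos hM, cylinderHom, aeval_X, if_neg (by simp)]
  rw [hX] at h
  have h0 := congrArg (eval (fun _ => (0 : Polynomial R))) h
  have h1 := congrArg (eval (fun _ => (1 : Polynomial R))) h
  simp only [map_add, map_sub, map_mul, map_pow, eval_X, eval_C, map_zero,
    IsScalarTower.algebraMap_apply K (Polynomial R) (MvPolynomial (Fin M) (Polynomial R)),
    algebraMap_eq] at h0 h1
  exact one_ne_zero (α := Polynomial R) (by linear_combination h1 - h0)

/-- `R` is the coordinate ring of the affine curve with equations
`z_k² = z_0² + ε_k z_{j(k)} - a`, `1 ≤ k ≤ m`, the homogeneous ideal of its projective closure is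
generated by the corresponding quadrics, and has height at least `m`. -/
structure IsTower (a : K) (ε : ℕ → K) (j : ℕ → ℕ) (m : ℕ) (z : ℕ → R) : Prop where
  relation : ∀ k, 1 ≤ k → k ≤ m →
    z k ^ 2 = z 0 ^ 2 + algebraMap K R (ε k) * z (j k) - algebraMap K R a
  adjoin_eq_top : Algebra.adjoin K (z '' Set.Iic m) = ⊤
  ker_eq : RingHom.ker (coneHom K (m + 2) z) =
    Ideal.span (towerQuadric a ε j (m + 2) '' Set.Icc 1 m)
  -- All `M` are allowed so that the primes of successive stages can be compared in one polynomial
  -- ring.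
  le_height : ∀ M, m + 2 ≤ M → (m : ℕ∞) ≤ (RingHom.ker (cylinderHom K m M z)).height

/-- A monomial `Z_0^p Z_1^q` goes to `x^q t^(p+q)`, from which `p` and `q` can be read off; thus the
cone over the line satisfies no equation. -/
theorem coeff_coeff_coneHom_X (F : MvPolynomial (Fin 2) K) (s : Fin 2 →₀ ℕ) :
    ((coneHom K 2 (fun _ => (Polynomial.X : Polynomial K)) F).coeff (s 0 + s 1)).coeff (s 1) =
      F.coeff s := by
  induction F using MvPolynomial.induction_on' with
  | monomial t c =>
    rw [coneHom, aeval_monomial, Finsupp.prod_fintype _ _ (by simp), Fin.prod_univ_two,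
      coeff_monomial]
    simp only [coneCoord, mul_pow]
    rw [show (algebraMap K (Polynomial (Polynomial K)) c *
      (Polynomial.X ^ t 0 * (Polynomial.C Polynomial.X ^ t 1 * Polynomial.X ^ t 1))) =
      Polynomial.C (Polynomial.C c * Polynomial.X ^ t 1) * Polynomial.X ^ (t 0 + t 1) by
        rw [show algebraMap K (Polynomial (Polynomial K)) c = Polynomial.C (Polynomial.C c) from rfl,
          map_mul, map_pow]
        ring, Polynomial.coeff_C_mul_X_pow]
    by_cases hts : t = s
    · subst hts; simp
    · rw [if_neg hts]
      split_ifs with h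
      · rw [Polynomial.coeff_C_mul_X_pow, if_neg]
        intro h1
        refine hts (Finsupp.ext fun i => ?_)
        fin_cases i
        · change t 0 = s 0
          omega
        · exact h1.symm
      · simp
  | add p q hp hq => simp only [map_add, Polynomial.coeff_add, hp, hq, coeff_add]

theorem isTower_polynomial (a : K) (ε : ℕ → K) (j : ℕ → ℕ) :
    IsTower a ε j 0 (fun _ => (Polynomial.X : Polynomial K)) where
  relation k h1 h2 := by omega
  adjoin_eq_top := by
    rw [show (fun _ : ℕ => (Polynomial.X : Polynomial K)) '' Set.Iic 0 = {Polynomial.X} by simp]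
    exact Polynomial.adjoin_X
  ker_eq := by
    rw [Set.Icc_eq_empty (by simp), Set.image_empty, Ideal.span_empty]
    refine (RingHom.ker_eq_bot_iff_eq_zero _).2 fun F hF => ?_
    ext s
    rw [← coeff_coeff_coneHom_X F s]
    change (((coneHom K 2 (fun _ => (Polynomial.X : Polynomial K)) F).coeff _).coeff _) = _
    rw [show coneHom K 2 (fun _ => (Polynomial.X : Polynomial K)) F = 0 from hF]
    simp
  le_height M hM := by simp

end Tower

/-! ### Adjoining one square root to a tower -/

section TowerStep

open MvPolynomial

variable {K : Type*} [Field K] {R : Type*} [CommRing R] [Algebra K R]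

/-- Division with remainder by the last quadric. -/
theorem exists_sub_mem_span_towerQuadric (a : K) (ε : ℕ → K) (j : ℕ → ℕ) (m : ℕ)
    (hj : j (m + 1) < m + 1) (F : MvPolynomial (Fin (m + 3)) K) :
    ∃ A B : MvPolynomial (Fin (m + 2)) K,
      F - (rename Fin.castSucc A + rename Fin.castSucc B * varOrZero K (m + 3) (m + 2)) ∈
        Ideal.span {towerQuadric a ε j (m + 3) (m + 1)} := by
  induction F using MvPolynomial.induction_on with
  | C c => exact ⟨C c, 0, by simp⟩
  | add p q hp hq =>
    obtain ⟨A, B, h⟩ := hp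
    obtain ⟨A', B', h'⟩ := hq
    refine ⟨A + A', B + B', ?_⟩
    have := add_mem h h'
    rw [map_add, map_add]
    convert this using 1
    ring
  | mul_X p i hp =>
    obtain ⟨A, B, h⟩ := hp
    rcases Fin.eq_castSucc_or_eq_last i with ⟨i, rfl⟩ | rfl
    · refine ⟨A * X i, B * X i, ?_⟩
      have := Ideal.mul_mem_right (X (Fin.castSucc i)) _ h
      rw [map_mul, map_mul, rename_X]
      convert this using 1
      ring
    · let G : MvPolynomial (Fin (m + 2)) K := varOrZero K (m + 2) 1 ^ 2 +
        C (ε (m + 1)) * (varOrZero K (m + 2) 0 * varOrZero K (m + 2) (j (m + 1) + 1)) -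
          C a * varOrZero K (m + 2) 0 ^ 2
      have hG : towerQuadric a ε j (m + 3) (m + 1) =
          varOrZero K (m + 3) (m + 2) ^ 2 - rename Fin.castSucc G := by
        simp only [G, map_add, map_sub, map_mul, map_pow, algHom_C, algebraMap_eq]
        rw [rename_castSucc_varOrZero (by omega), rename_castSucc_varOrZero (by omega),
          rename_castSucc_varOrZero (by omega), towerQuadric]
        ring
      have hX : (X (Fin.last (m + 2)) : MvPolynomial (Fin (m + 3)) K) =
          varOrZero K (m + 3) (m + 2) := by
        rw [varOrZero, dif_pos (by omega)]; rfl
      -- Modulo the quadric `Z² - G`, one has `(A + B Z) Z ≡ B G + A Z`.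
      refine ⟨B * G, A, ?_⟩
      have h1 := Ideal.mul_mem_right (X (Fin.last (m + 2))) _ h
      have h2 := Ideal.mul_mem_left _ (rename Fin.castSucc B)
        (Ideal.mem_span_singleton_self (towerQuadric a ε j (m + 3) (m + 1)))
      have h3 := add_mem h1 h2
      rw [map_mul, hX] at *
      rw [hG] at h3 ⊢
      convert h3 using 1
      ring

variable {a : K} {ε : ℕ → K} {j : ℕ → ℕ} {m : ℕ} {z : ℕ → R}

open QuadraticAlgebra in
/-- The coordinates after the adjunction of a square root. -/
def adjoinSqrt (z : ℕ → R) (m : ℕ) (g : R) (k : ℕ) : QuadraticAlgebra R g 0 :=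
  if k ≤ m then algebraMap R _ (z k) else omega

theorem adjoinSqrt_of_le {g : R} {k : ℕ} (h : k ≤ m) :
    adjoinSqrt z m g k = algebraMap R _ (z k) := if_pos h

open QuadraticAlgebra in
theorem adjoinSqrt_succ {g : R} : adjoinSqrt z m g (m + 1) = omega := if_neg (by omega)

theorem coneCoord_adjoinSqrt_of_le {g : R} {i : ℕ} (h : i ≤ m + 1) :
    coneCoord (adjoinSqrt z m g) i =
      Polynomial.mapRingHom (algebraMap R (QuadraticAlgebra R g 0)) (coneCoord z i) := by
  cases i with
  | zero => simp [coneCoord]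
  | succ i =>
    simp only [coneCoord]
    rw [adjoinSqrt_of_le (by omega)]
    simp

theorem coneHom_adjoinSqrt_rename {g : R} (A : MvPolynomial (Fin (m + 2)) K) :
    coneHom K (m + 3) (adjoinSqrt z m g) (rename Fin.castSucc A) =
      Polynomial.mapRingHom (algebraMap R (QuadraticAlgebra R g 0)) (coneHom K (m + 2) z A) := by
  induction A using MvPolynomial.induction_on with
  | C c =>
    rw [rename_C, algHom_C, algHom_C, Polynomial.algebraMap_apply, Polynomial.algebraMap_apply,
      Polynomial.coe_mapRingHom, Polynomial.map_C]
    rfl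
  | add p q hp hq => simp only [map_add, hp, hq]
  | mul_X p i hp =>
    have h1 : coneHom K (m + 3) (adjoinSqrt z m g) (X i.castSucc) =
        coneCoord (adjoinSqrt z m g) i := by rw [coneHom, aeval_X]; rfl
    have h2 : coneHom K (m + 2) z (X i) = coneCoord z i := by rw [coneHom, aeval_X]
    rw [map_mul, map_mul, hp, map_mul, map_mul, rename_X, h1, h2,
      ← coneCoord_adjoinSqrt_of_le (Nat.lt_succ_iff.1 i.2)]

theorem IsTower.adjoinSqrt_relation (h : IsTower a ε j m z) (hj : ∀ k, 1 ≤ k → j k < k) {k : ℕ}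
    (hk : 1 ≤ k) (hkm : k ≤ m + 1) {g : R}
    (hg : g = z 0 ^ 2 + algebraMap K R (ε (m + 1)) * z (j (m + 1)) - algebraMap K R a) :
    adjoinSqrt z m g k ^ 2 = adjoinSqrt z m g 0 ^ 2 + algebraMap K (QuadraticAlgebra R g 0) (ε k) *
      adjoinSqrt z m g (j k) - algebraMap K (QuadraticAlgebra R g 0) a := by
  have hjk := hj k hk
  rw [adjoinSqrt_of_le (k := 0) (by omega), adjoinSqrt_of_le (k := j k) (by omega),
    IsScalarTower.algebraMap_apply K R (QuadraticAlgebra R g 0),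
    IsScalarTower.algebraMap_apply K R (QuadraticAlgebra R g 0)]
  rcases Nat.lt_or_ge m k with hlt | hle
  · obtain rfl : k = m + 1 := by omega
    rw [adjoinSqrt_succ, QuadraticAlgebra.omega_sq, ← map_pow, ← map_mul, ← map_add, ← map_sub, hg]
  · rw [adjoinSqrt_of_le hle, ← map_pow, ← map_pow, ← map_mul, ← map_add, ← map_sub,
      h.relation k hk hle]

/-- Adjoining the square root of `z_0² + ε z_j - a` to a tower. -/
theorem IsTower.adjoinSqrt (h : IsTower a ε j m z) (hj : ∀ k, 1 ≤ k → j k < k) {g : R}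
    (hg : g = z 0 ^ 2 + algebraMap K R (ε (m + 1)) * z (j (m + 1)) - algebraMap K R a)
    [IsDomain R] [IsDomain (QuadraticAlgebra R g 0)] :
    IsTower a ε j (m + 1) (adjoinSqrt z m g) where
  relation k hk hkm := h.adjoinSqrt_relation hj hk hkm hg
  adjoin_eq_top := by
    have hmem : ∀ k ≤ m + 1, _root_.adjoinSqrt z m g k ∈
        Algebra.adjoin K (_root_.adjoinSqrt z m g '' Set.Iic (m + 1)) :=
      fun k hk => Algebra.subset_adjoin ⟨k, hk, rfl⟩
    have hR : ∀ r : R, algebraMap R (QuadraticAlgebra R g 0) r ∈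
        Algebra.adjoin K (_root_.adjoinSqrt z m g '' Set.Iic (m + 1)) := by
      intro r
      have h1 : Algebra.adjoin K (z '' Set.Iic m) ≤ (Algebra.adjoin K
          (_root_.adjoinSqrt z m g '' Set.Iic (m + 1))).comap
            (IsScalarTower.toAlgHom K R (QuadraticAlgebra R g 0)) := by
        refine Algebra.adjoin_le ?_
        rintro _ ⟨k, hk, rfl⟩
        have := hmem k (Nat.le_succ_of_le hk)
        rwa [adjoinSqrt_of_le hk] at this
      rw [h.adjoin_eq_top] at h1
      exact h1 (Algebra.mem_top (x := r))
    refine top_le_iff.1 fun y _ => ?_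
    rw [y.eq_algebraMap_add]
    refine add_mem (hR _) (mul_mem (hR _) ?_)
    have := hmem (m + 1) le_rfl
    rwa [adjoinSqrt_succ] at this
  ker_eq := by
    have hle : Ideal.span (towerQuadric a ε j (m + 1 + 2) '' Set.Icc 1 (m + 1)) ≤
        RingHom.ker (coneHom K (m + 1 + 2) (_root_.adjoinSqrt z m g)) := by
      refine Ideal.span_le.2 ?_
      rintro _ ⟨k, ⟨hk, hkm⟩, rfl⟩
      exact coneHom_towerQuadric (h.adjoinSqrt_relation hj hk hkm hg) (hj k hk) (by omega)
    refine le_antisymm (fun F hF => ?_) hle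
    obtain ⟨A, B, hAB⟩ := exists_sub_mem_span_towerQuadric a ε j m (hj _ (by omega)) F
    have hAB' : F - (rename Fin.castSucc A +
        rename Fin.castSucc B * varOrZero K (m + 3) (m + 2)) ∈
        Ideal.span (towerQuadric a ε j (m + 1 + 2) '' Set.Icc 1 (m + 1)) :=
      by
      refine Ideal.span_mono (Set.singleton_subset_iff.2 ?_) hAB
      exact ⟨m + 1, by simp, rfl⟩
    have h0 : coneHom K (m + 3) (_root_.adjoinSqrt z m g) (rename Fin.castSucc A +
        rename Fin.castSucc B * varOrZero K (m + 3) (m + 2)) = 0 := by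
      have := sub_mem hF (hle hAB')
      rwa [sub_sub_cancel] at this
    rw [map_add, map_mul, coneHom_adjoinSqrt_rename, coneHom_adjoinSqrt_rename,
      coneHom_varOrZero _ (by omega), coneCoord, adjoinSqrt_succ] at h0
    -- The remainder maps to `A(cone) + √g t B(cone)`; since `1` and `√g` are independent over `R`,
    -- both parts vanish.
    have hcoeff : ∀ n, (coneHom K (m + 2) z A).coeff n = 0 ∧
        (coneHom K (m + 2) z B * Polynomial.X).coeff n = 0 := by
      intro n
      have h1 := congrArg (fun p => p.coeff n) h0
      simp only [Polynomial.coeff_add, Polynomial.coe_mapRingHom, Polynomial.coeff_map,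
        Polynomial.coeff_zero] at h1
      rw [mul_left_comm, Polynomial.coeff_C_mul] at h1
      have h2 : (Polynomial.map (algebraMap R (QuadraticAlgebra R g 0)) (coneHom K (m + 2) z B) *
          Polynomial.X).coeff n = algebraMap R _ ((coneHom K (m + 2) z B * Polynomial.X).coeff n) := by
        rw [← Polynomial.coeff_map, Polynomial.map_mul, Polynomial.map_X]
      rw [h2] at h1
      have hre := congrArg QuadraticAlgebra.re h1
      have him := congrArg QuadraticAlgebra.im h1
      simp at hre him
      exact ⟨hre, him⟩
    have hA : A ∈ RingHom.ker (coneHom K (m + 2) z) :=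
      Polynomial.ext fun n => by rw [(hcoeff n).1, Polynomial.coeff_zero]
    have hB : B ∈ RingHom.ker (coneHom K (m + 2) z) := by
      have h1 : coneHom K (m + 2) z B * Polynomial.X = 0 :=
        Polynomial.ext fun n => by rw [(hcoeff n).2, Polynomial.coeff_zero]
      exact (mul_eq_zero.1 h1).resolve_right Polynomial.X_ne_zero
    have hren : ∀ A ∈ RingHom.ker (coneHom K (m + 2) z), rename Fin.castSucc A ∈
        Ideal.span (towerQuadric a ε j (m + 1 + 2) '' Set.Icc 1 (m + 1)) := by
      intro A hA
      rw [h.ker_eq] at hA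
      have h1 := Ideal.mem_map_of_mem (rename Fin.castSucc : MvPolynomial (Fin (m + 2)) K →ₐ[K] _) hA
      rw [Ideal.map_span] at h1
      refine Ideal.span_le.2 ?_ h1
      rintro _ ⟨_, ⟨k, hk, rfl⟩, rfl⟩
      obtain ⟨hk, hkm⟩ := hk
      refine Ideal.subset_span ⟨k, ⟨hk, by omega⟩, ?_⟩
      exact (rename_castSucc_towerQuadric a ε (hj k hk) (by omega)).symm
    have h2 := add_mem hAB' (add_mem (hren A hA) (Ideal.mul_mem_right
      (varOrZero K (m + 3) (m + 2)) _ (hren B hB)))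
    rwa [sub_add_cancel] at h2
  le_height M hM := by
    have hp : (RingHom.ker (cylinderHom K m M z)).IsPrime := RingHom.ker_isPrime _
    have hp' : (RingHom.ker (cylinderHom K (m + 1) M (_root_.adjoinSqrt z m g))).IsPrime :=
      RingHom.ker_isPrime _
    have hlt : RingHom.ker (cylinderHom K m M z) <
        RingHom.ker (cylinderHom K (m + 1) M (_root_.adjoinSqrt z m g)) := by
      refine lt_of_le_of_ne (fun F hF => ?_) fun heq => ?_
      · let θ : MvPolynomial (Fin M) (Polynomial R) →+*
            MvPolynomial (Fin M) (Polynomial (QuadraticAlgebra R g 0)) :=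
          eval₂Hom (C.comp (Polynomial.mapRingHom (algebraMap R (QuadraticAlgebra R g 0))))
            fun i => if (i : ℕ) ≤ m + 2 then C (coneCoord (_root_.adjoinSqrt z m g) i) else X i
        have hθ : (θ.comp (cylinderHom K m M z).toRingHom) =
            (cylinderHom K (m + 1) M (_root_.adjoinSqrt z m g)).toRingHom := by
          refine MvPolynomial.ringHom_ext (fun c => ?_) fun i => ?_
          · change θ (cylinderHom K m M z (C c)) =
              cylinderHom K (m + 1) M (_root_.adjoinSqrt z m g) (C c)
            rw [algHom_C, algHom_C, IsScalarTower.algebraMap_apply K (Polynomial R)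
              (MvPolynomial (Fin M) (Polynomial R)), IsScalarTower.algebraMap_apply K
              (Polynomial (QuadraticAlgebra R g 0))
              (MvPolynomial (Fin M) (Polynomial (QuadraticAlgebra R g 0))), algebraMap_eq,
              algebraMap_eq, Polynomial.algebraMap_apply, Polynomial.algebraMap_apply]
            simp only [θ, eval₂Hom_C, RingHom.comp_apply, Polynomial.coe_mapRingHom,
              Polynomial.map_C]
            rfl
          · change θ (cylinderHom K m M z (X i)) =
              cylinderHom K (m + 1) M (_root_.adjoinSqrt z m g) (X i)
            rw [cylinderHom, aeval_X, cylinderHom, aeval_X]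
            by_cases h1 : (i : ℕ) ≤ m + 1
            · rw [if_pos h1, if_pos (by omega), coneCoord_adjoinSqrt_of_le h1]
              simp [θ]
            · rw [if_neg h1]
              simp [θ]
        have h1 := RingHom.congr_fun hθ F
        change θ (cylinderHom K m M z F) = _ at h1
        rw [show cylinderHom K m M z F = 0 from hF, map_zero] at h1
        exact h1.symm
      · refine cylinderHom_towerQuadric_succ_ne_zero (a := a) (ε := ε) (z := z)
          (hj (m + 1) (by omega)) (by omega : m + 2 < M) ?_
        have h1 : towerQuadric a ε j M (m + 1) ∈
            RingHom.ker (cylinderHom K (m + 1) M (_root_.adjoinSqrt z m g)) :=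
          cylinderHom_towerQuadric (h.adjoinSqrt_relation hj (by omega) le_rfl hg)
            (hj (m + 1) (by omega)) (by omega) le_rfl
        rwa [← heq] at h1
    push_cast
    exact (add_le_add_left (h.le_height M (by omega)) 1).trans
      (Ideal.height_add_one_le_of_lt_of_isPrime hlt)

end TowerStep

/-! ### From the Jacobian criterion to squarefreeness -/

section Gradients

variable {K : Type*} [Field K]

/-- The gradient at `ζ` of the equation `z_k² - z_0² - ε_k z_{j(k)} + a`. -/
def towerGradient {E : Type*} [Field E] [Algebra K E] (ε : ℕ → K) (j : ℕ → ℕ) (ζ : ℕ → E)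
    (k l : ℕ) : E :=
  (if l = k then 2 * ζ k else 0) - (if l = 0 then 2 * ζ 0 else 0) -
    (if l = j k then algebraMap K E (ε k) else 0)

/-- The Jacobian criterion: the gradients of the equations `z_k² = z_0² + ε_k z_{j(k)} - a`,
`1 ≤ k ≤ n`, are linearly independent at all their common zeros. -/
def HasIndependentGradients (E : Type*) [Field E] [Algebra K E] (a : K) (ε : ℕ → K) (j : ℕ → ℕ)
    (n : ℕ) : Prop :=
  ∀ ζ : ℕ → E, (∀ k, 1 ≤ k → k ≤ n →
      ζ k ^ 2 = ζ 0 ^ 2 + algebraMap K E (ε k) * ζ (j k) - algebraMap K E a) →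
    ∀ μ : ℕ → E, (∀ l, ∑ k ∈ Finset.Icc 1 n, μ k * towerGradient ε j ζ k l = 0) →
      ∀ k ∈ Finset.Icc 1 n, μ k = 0

/-- A point of a stage of the tower lifts to the later stages. -/
theorem exists_extend_point {E : Type*} [Field E] [IsAlgClosed E] [Algebra K E] (a : K)
    (ε : ℕ → K) {j : ℕ → ℕ} (hj : ∀ k, 1 ≤ k → j k < k) (m : ℕ) (ζ₀ : ℕ → E) (n : ℕ) :
    ∃ ζ : ℕ → E, (∀ k ≤ m, ζ k = ζ₀ k) ∧ ∀ k, m < k → k ≤ n →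
      ζ k ^ 2 = ζ 0 ^ 2 + algebraMap K E (ε k) * ζ (j k) - algebraMap K E a := by
  induction n with
  | zero => exact ⟨ζ₀, fun _ _ => rfl, fun k h1 h2 => by omega⟩
  | succ n ih =>
    obtain ⟨ζ, h1, h2⟩ := ih
    by_cases hn : m < n + 1
    · obtain ⟨w, hw⟩ := IsAlgClosed.exists_pow_nat_eq
        (ζ 0 ^ 2 + algebraMap K E (ε (n + 1)) * ζ (j (n + 1)) - algebraMap K E a) two_pos
      refine ⟨Function.update ζ (n + 1) w, fun k hk => ?_, fun k hk hkn => ?_⟩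
      · rw [Function.update_of_ne (by omega), h1 k hk]
      · have hjk := hj k (by omega)
        rw [Function.update_of_ne (by omega : (0 : ℕ) ≠ n + 1),
          Function.update_of_ne (by omega : j k ≠ n + 1)]
        rcases Nat.lt_or_ge n k with hlt | hge
        · obtain rfl : k = n + 1 := by omega
          rw [Function.update_self, hw]
        · rw [Function.update_of_ne (by omega), h2 k hk hge]
    · exact ⟨ζ, h1, fun k hk hkn => by omega⟩

variable {R : Type*} [CommRing R] [Algebra K R]

/-- By the Leibniz rule, a derivation that maps algebra generators into `M` maps everything into
`M`. Hence the tangent vector `(D z_l)` is nonzero at every point. -/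
theorem Derivation.exists_apply_notMem (D : Derivation K R R)
    (hD : Ideal.span (Set.range D) = ⊤) {s : Set R} (hs : Algebra.adjoin K s = ⊤) (M : Ideal R)
    (hM : M ≠ ⊤) : ∃ y ∈ s, D y ∉ M := by
  by_contra! h
  refine hM (top_le_iff.1 (hD ▸ Ideal.span_le.2 ?_))
  rintro _ ⟨y, rfl⟩
  have hy : y ∈ Algebra.adjoin K s := by rw [hs]; exact Algebra.mem_top
  induction hy using Algebra.adjoin_induction with
  | mem y hy => exact h y hy
  | algebraMap c => simp
  | add y w _ _ hy hw => rw [map_add]; exact add_mem hy hw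
  | mul y w _ _ hy hw =>
    rw [Derivation.leibniz]
    exact add_mem (M.mul_mem_left _ hw) (M.mul_mem_left _ hy)

/-- By the Jacobian criterion, the functions of which square roots are adjoined are squarefree. -/
theorem HasIndependentGradients.notMem_sq {E : Type*} [Field E] [IsAlgClosed E] [CharZero E]
    [Algebra K E] {a : K} {ε : ℕ → K} {j : ℕ → ℕ} {n : ℕ}
    (hind : HasIndependentGradients E a ε j n) (hj : ∀ k, 1 ≤ k → j k < k) {m : ℕ} (hm : m < n)
    {z : ℕ → R} (hz : IsTower a ε j m z) [Algebra.FiniteType K R] (D : Derivation K R R)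
    (hD : Ideal.span (Set.range D) = ⊤) (M : Ideal R) (hM : M.IsMaximal) :
    z 0 ^ 2 + algebraMap K R (ε (m + 1)) * z (j (m + 1)) - algebraMap K R a ∉ M ^ 2 := by
  intro hg
  set g := z 0 ^ 2 + algebraMap K R (ε (m + 1)) * z (j (m + 1)) - algebraMap K R a with hgdef
  let := Ideal.Quotient.field M
  have : Module.Finite K (R ⧸ M) := finite_of_finite_type_of_isJacobsonRing K (R ⧸ M)
  let φ : (R ⧸ M) →ₐ[K] E := IsAlgClosed.lift
  let ψ : R →ₐ[K] E := φ.comp (Ideal.Quotient.mkₐ K M)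
  have hψ : ∀ y, ψ y = 0 ↔ y ∈ M := by
    intro y
    rw [← Ideal.Quotient.eq_zero_iff_mem]
    exact map_eq_zero_iff φ φ.toRingHom.injective
  have hψ2 : ∀ y ∈ M ^ 2, ψ (D y) = 0 := by
    intro y hy
    rw [hψ]
    rw [pow_two] at hy
    refine Submodule.mul_induction_on hy (fun x hx y hy => ?_) (fun x y hx hy => ?_)
    · rw [Derivation.leibniz]
      exact add_mem (M.mul_mem_right _ hx) (M.mul_mem_right _ hy)
    · rw [map_add]; exact add_mem hx hy
  -- The criterion concerns all `n` equations, so the point of stage `m` defined by `M` is extended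
  -- to the whole tower.
  obtain ⟨ζ, hζ, hζ'⟩ := exists_extend_point a ε hj m (fun k => ψ (z k)) n
  have hrel : ∀ k, 1 ≤ k → k ≤ n →
      ζ k ^ 2 = ζ 0 ^ 2 + algebraMap K E (ε k) * ζ (j k) - algebraMap K E a := by
    intro k hk hkn
    rcases Nat.lt_or_ge m k with hlt | hle
    · exact hζ' k hlt hkn
    · have hjk := hj k hk
      rw [hζ k hle, hζ 0 (by omega), hζ (j k) (by omega), ← map_pow, hz.relation k hk hle]
      simp
  have hζm : ζ (m + 1) = 0 := by
    have h1 := hrel (m + 1) (by omega) hm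
    have hjm := hj (m + 1) (by omega)
    rw [hζ 0 (by omega), hζ (j (m + 1)) (by omega)] at h1
    have h2 : ψ g = 0 := (hψ g).2 (Ideal.pow_le_self two_ne_zero hg)
    rw [hgdef] at h2
    simp only [map_add, map_sub, map_mul, map_pow, AlgHom.commutes] at h2
    rw [h2] at h1
    exact pow_eq_zero_iff two_ne_zero |>.1 h1
  -- The tangent vector at the point. It is killed by the gradients of the `m` relations and, as `g
  -- ∈ M ^ 2`, by that of `g`. These are the rows of the square matrix `A`, so they are dependent.
  let v : Fin (m + 1) → E := fun l => ψ (D (z l))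
  let A : Matrix (Fin (m + 1)) (Fin (m + 1)) E :=
    Matrix.of fun i l => towerGradient ε j ζ (i + 1) l
  have hv : v ≠ 0 := by
    obtain ⟨_, ⟨k, hk, rfl⟩, hkM⟩ := D.exists_apply_notMem hD hz.adjoin_eq_top M hM.ne_top
    intro h0
    have h1 := congrFun h0 ⟨k, Nat.lt_succ_of_le hk⟩
    exact hkM ((hψ _).1 h1)
  have hAv : A.mulVec v = 0 := by
    ext i
    have hji := hj (i + 1) (by omega)
    have hsum : A.mulVec v i = ∑ l ∈ Finset.range (m + 1),
        towerGradient ε j ζ (i + 1) l * ψ (D (z l)) := by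
      rw [Matrix.mulVec, dotProduct, ← Fin.sum_univ_eq_sum_range
        (fun l => towerGradient ε j ζ (i + 1) l * ψ (D (z l)))]
      rfl
    have hexp : A.mulVec v i = (if (i : ℕ) + 1 ≤ m then 2 * ζ (i + 1) * ψ (D (z (i + 1))) else 0) -
        2 * ζ 0 * ψ (D (z 0)) - algebraMap K E (ε (i + 1)) * ψ (D (z (j (i + 1)))) := by
      rw [hsum]
      simp only [towerGradient, sub_mul, ite_mul, zero_mul, Finset.sum_sub_distrib,
        Finset.sum_ite_eq', Finset.mem_range]
      have e1 : 0 < m + 1 := by omega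
      have e2 : j (↑i + 1) < m + 1 := by omega
      simp only [e1, e2, if_true, Nat.lt_succ_iff]
    rw [hexp, Pi.zero_apply]
    have h2ψ : ψ 2 = 2 := map_ofNat ψ 2
    have hDrel : ∀ y : R, y = z 0 ^ 2 + algebraMap K R (ε (i + 1)) * z (j (i + 1)) -
        algebraMap K R a → ψ (D y) =
          2 * ζ 0 * ψ (D (z 0)) + algebraMap K E (ε (i + 1)) * ψ (D (z (j (i + 1)))) := by
      rintro y rfl
      rw [hζ 0 (by omega)]
      simp only [map_add, map_sub, Derivation.leibniz, Derivation.leibniz_pow,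
        Derivation.map_algebraMap, map_mul, smul_eq_mul, map_pow, nsmul_eq_mul,
        AlgHom.commutes]
      simp [h2ψ]
      ring
    split_ifs with him
    · have h1 := hDrel _ (hz.relation (i + 1) (by omega) him)
      rw [Derivation.leibniz_pow] at h1
      simp only [smul_eq_mul, map_mul, nsmul_eq_mul, map_pow] at h1
      rw [hζ _ him]
      simp only [Nat.cast_ofNat, Nat.add_one_sub_one, pow_one, h2ψ] at h1
      linear_combination h1
    · have hi : (i : ℕ) = m := by omega
      have h1 := hDrel g (by rw [hgdef, hi])
      rw [hψ2 g hg] at h1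
      linear_combination h1
  obtain ⟨μ, hμ0, hμ⟩ := Matrix.exists_vecMul_eq_zero_iff.2
    (Matrix.exists_mulVec_eq_zero_iff.1 ⟨v, hv, hAv⟩)
  let μ' : ℕ → E := fun k => if h : k - 1 < m + 1 then μ ⟨k - 1, h⟩ else 0
  have hμ' : ∀ i : Fin (m + 1), μ' (i + 1) = μ i := by
    intro i
    simp only [μ']
    rw [dif_pos (by omega)]
    congr 1
  have hzero := hind ζ hrel μ' fun l => by
    have hsub : ∑ k ∈ Finset.Icc 1 n, μ' k * towerGradient ε j ζ k l =
        ∑ k ∈ Finset.Icc 1 (m + 1), μ' k * towerGradient ε j ζ k l := by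
      refine (Finset.sum_subset (Finset.Icc_subset_Icc_right hm) fun k hk hk' => ?_).symm
      rw [Finset.mem_Icc] at hk hk'
      have : μ' k = 0 := dif_neg (by omega)
      rw [this, zero_mul]
    have hfin : ∑ k ∈ Finset.Icc 1 (m + 1), μ' k * towerGradient ε j ζ k l =
        ∑ i : Fin (m + 1), μ i * towerGradient ε j ζ (i + 1) l := by
      have h1 : Finset.Icc 1 (m + 1) = Finset.Ico (0 + 1) (m + 1 + 1) := by
        ext k
        simp only [Finset.mem_Icc, Finset.mem_Ico]
        omega
      rw [h1, ← Finset.sum_Ico_add' (fun k => μ' k * towerGradient ε j ζ k l),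
        ← Finset.range_eq_Ico,
        ← Fin.sum_univ_eq_sum_range (fun k => μ' (k + 1) * towerGradient ε j ζ (k + 1) l)]
      exact Finset.sum_congr rfl fun i _ => by rw [hμ']
    rw [hsub, hfin]
    -- The columns outside `A` vanish: column `m + 1` has the single possible entry `2 ζ_{m+1}`,
    -- which is zero because `g` vanishes at the point.
    by_cases hl : l < m + 1
    · exact congrFun hμ ⟨l, hl⟩
    · refine Finset.sum_eq_zero fun i _ => ?_
      have hji := hj (i + 1) (by omega)
      have : towerGradient ε j ζ (i + 1) l = 0 := by
        unfold towerGradient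
        rw [if_neg (by omega : ¬ l = 0), if_neg (by omega : ¬ l = j (i + 1))]
        split_ifs with h1
        · rw [← h1, show l = m + 1 by omega, hζm]; simp
        · simp
      rw [this, mul_zero]
  refine hμ0 (funext fun i => ?_)
  rw [← hμ' i]
  exact hzero _ (Finset.mem_Icc.2 ⟨by omega, by omega⟩)

end Gradients

/-! ### Construction of the whole tower -/

section Existence

variable {K L : Type u} [Field K] [CharZero K] [Field L] [Algebra K L]
  {V : ValuationSubring L} {s : L} {δ : Derivation K L L} (hV : IsPlaceAtInfinity V s δ)

omit [CharZero K] in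
theorem algebraMap_mem_poleOrderLE {R : Type*} [CommRing R] [Algebra K R] (x : R) (c : K) {d : ℤ}
    (hd : 0 ≤ d) : algebraMap K R c ∈ poleOrderLE hV x d := by
  intro τ _
  rw [AlgHom.commutes]
  exact ((V.valuation_le_one_iff _).2 (hV.algebraMap_mem c)).trans (one_le_zpow₀ hV.one_lt.le hd)

/-- Both structures run through one induction: squarefreeness of the next `g` uses the generators
and relations of the tower and the nowhere vanishing derivation of the model. -/
theorem exists_isModel_and_isTower {E : Type*} [Field E] [IsAlgClosed E] [CharZero E] [Algebra K E]
    {a : K} {ε : ℕ → K} {j : ℕ → ℕ} {n : ℕ} (hj : ∀ k, 1 ≤ k → j k < k)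
    (hind : HasIndependentGradients E a ε j n) (m : ℕ) (hm : m ≤ n) :
    ∃ (R : Type u) (_ : CommRing R) (_ : Algebra K R) (z : ℕ → R) (D : Derivation K R R),
      IsModel hV (z 0) (∏ k ∈ Finset.Icc 1 m, z k) D m ∧ IsTower a ε j m z ∧
        ∀ k ≤ m, z k ∈ poleOrderLE hV (z 0) 1 := by
  induction m with
  | zero =>
    refine ⟨Polynomial K, inferInstance, inferInstance, fun _ => Polynomial.X, _,
      isModel_polynomial hV, isTower_polynomial a ε j, fun k _ τ hτ => ?_⟩
    rw [hτ, zpow_one]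
  | succ m ih =>
    obtain ⟨R, _, _, z, D, hM, hT, hz⟩ := ih (by omega)
    have := hM.isDedekindDomain
    have := hM.finiteType
    have hjm := hj (m + 1) (by omega)
    obtain ⟨g, hg⟩ : ∃ g, g = z 0 ^ 2 + algebraMap K R (ε (m + 1)) * z (j (m + 1)) -
      algebraMap K R a := ⟨_, rfl⟩
    have hg2 : ∀ M : Ideal R, M.IsMaximal → g ∉ M ^ 2 := by
      rw [hg]
      exact hind.notMem_sq hj (by omega) hT D hM.span_range
    have hg1 : g - z 0 ^ 2 ∈ poleOrderLE hV (z 0) 1 := by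
      rw [hg, add_sub_assoc, add_sub_cancel_left]
      refine sub_mem ?_ (algebraMap_mem_poleOrderLE hV _ _ zero_le_one)
      rw [← Algebra.smul_def]
      exact Submodule.smul_mem _ _ (hz _ (by omega))
    have hM' := hM.quadraticAlgebra hg1 hg2
    have := hM'.isDedekindDomain
    refine ⟨QuadraticAlgebra R g 0, inferInstance, inferInstance, adjoinSqrt z m g,
      QuadraticAlgebra.derivationOmegaMul D g, ?_,
      hT.adjoinSqrt hj hg, fun k hk => ?_⟩
    · rw [Finset.prod_Icc_succ_top (by omega), adjoinSqrt_succ, adjoinSqrt_of_le (by omega),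
        Finset.prod_congr rfl fun k hk => adjoinSqrt_of_le (Finset.mem_Icc.1 hk).2, ← map_prod]
      exact hM'
    · rw [adjoinSqrt_of_le (by omega : 0 ≤ m), mem_poleOrderLE_quadraticAlgebra hg1]
      rcases Nat.lt_or_ge m k with hlt | hle
      · obtain rfl : k = m + 1 := by omega
        rw [adjoinSqrt_succ]
        refine ⟨zero_mem _, ?_⟩
        have := algebraMap_mem_poleOrderLE hV (z 0) (1 : K) (d := 1 - 1) (by norm_num)
        rwa [map_one] at this
      · rw [adjoinSqrt_of_le hle]
        exact ⟨hz k hle, zero_mem _⟩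

end Existence

/-! ### Arrangements as towers, and the fiber ideal -/

namespace PreimageArrangement

open MvPolynomial

variable {K : Type*} [Field K] {n : ℕ}

theorem target_zero (T : PreimageArrangement (n + 1)) : T.target 0 = none := by
  rcases h : T.target 0 with _ | ⟨j, ε⟩
  · rfl
  · exact absurd (T.target_lt 0 j ε h) (Fin.not_lt_zero j)

/-- An arrangement is described by a sequence of signs and a sequence of indices. -/
structure IsDescribedBy (T : PreimageArrangement (n + 1)) (ε : ℕ → K) (j : ℕ → ℕ) : Prop where
  lt : ∀ k, 1 ≤ k → j k < k
  image_zero : ∀ a : K, T.image a 0 = C a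
  image_of_ne_zero : ∀ (a : K) (k i : Fin (n + 1)), k ≠ 0 → (i : ℕ) = j k →
    T.image a k = C (ε k) * X (some i)

/-- Injectivity of `target` ensures that only the pair `0` maps to `a`. Indices that name no such
pair get the values zero. -/
theorem exists_isDescribedBy (K : Type*) [Field K] (T : PreimageArrangement (n + 1)) :
    ∃ (ε : ℕ → K) (j : ℕ → ℕ), T.IsDescribedBy ε j := by
  have h (k : ℕ) : ∃ (ε : K) (j : ℕ), (1 ≤ k → j < k) ∧
      ∀ (a : K) (k' i : Fin (n + 1)), (k' : ℕ) = k → k' ≠ 0 → (i : ℕ) = j →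
        T.image a k' = C ε * X (some i) := by
    by_cases hk : 1 ≤ k ∧ k < n + 1
    · have h0 : (⟨k, hk.2⟩ : Fin (n + 1)) ≠ 0 := by
        rw [Ne, Fin.ext_iff]; exact (by omega : k ≠ 0)
      rcases h : T.target ⟨k, hk.2⟩ with _ | ⟨j, ε⟩
      · exact absurd (T.target_injective (h.trans T.target_zero.symm)) h0
      · refine ⟨((ε : ℤ) : K), j, fun _ => T.target_lt _ _ _ h, fun a k' i hk' _ hi => ?_⟩
        obtain rfl : k' = ⟨k, hk.2⟩ := Fin.ext hk'
        obtain rfl : i = j := Fin.ext hi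
        rw [image, h]
        simp
    · refine ⟨0, 0, fun h => h, fun a k' i hk' h0 _ => ?_⟩
      have := k'.2
      rw [Ne, Fin.ext_iff] at h0
      change ¬ (k' : ℕ) = 0 at h0
      omega
  choose ε j h1 h2 using h
  refine ⟨ε, j, h1, fun a => ?_, fun a k i hk hi => h2 k a k i rfl hk hi⟩
  rw [image, T.target_zero]

/-- The substitution `Z_0 = 1`, `Z_{i+1} = z_i`. -/
noncomputable def dehomogenize (K : Type*) [Field K] (n : ℕ) :
    MvPolynomial (Fin (n + 1)) K →ₐ[K] MvPolynomial (Option (Fin n)) K :=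
  aeval (Fin.cons 1 fun i => X (some i))

/-- The equation of the affine curve for the `i`-th pair. -/
noncomputable def equation (T : PreimageArrangement n) (a : K) (i : Fin n) :
    MvPolynomial (Option (Fin n)) K :=
  X (some i) ^ 2 + X none - T.image a i

theorem affineIdeal_eq_span (T : PreimageArrangement n) (a : K) :
    T.affineIdeal a = Ideal.span (Set.range (T.equation a)) := rfl

section Point

variable {R : Type*} [CommRing R] [Algebra K R]

/-- The evaluation at the point of the affine curve with first coordinates `z`. -/
noncomputable def pointHom (a : K) (n : ℕ) (z : ℕ → R) :
    MvPolynomial (Option (Fin n)) K →ₐ[K] R :=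
  aeval fun o => o.elim (algebraMap K R a - z 0 ^ 2) fun i => z i

theorem pointHom_X_some (a : K) (z : ℕ → R) (i : Fin n) : pointHom a n z (X (some i)) = z i := by
  rw [pointHom, aeval_X]; rfl

theorem pointHom_X_none (a : K) (z : ℕ → R) :
    pointHom a n z (X none) = algebraMap K R a - z 0 ^ 2 := by
  rw [pointHom, aeval_X]; rfl

theorem pointHom_dehomogenize (a : K) (z : ℕ → R) (F : MvPolynomial (Fin (n + 1)) K) :
    pointHom a n z (dehomogenize K n F) = aeval (Fin.cons 1 fun i : Fin n => z i) F := by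
  have : (pointHom a n z).comp (dehomogenize K n) = aeval (Fin.cons 1 fun i : Fin n => z i) := by
    refine algHom_ext fun i => ?_
    rw [AlgHom.comp_apply, dehomogenize, aeval_X, aeval_X]
    refine Fin.cases ?_ (fun i => ?_) i
    · simp
    · simp [pointHom_X_some]
  rw [← this, AlgHom.comp_apply]

theorem coneHom_of_isHomogeneous {d : ℕ} (z : ℕ → R) {F : MvPolynomial (Fin (n + 1)) K}
    (hF : F.IsHomogeneous d) : coneHom K (n + 1) z F =
      Polynomial.C (aeval (Fin.cons 1 fun i : Fin n => z i) F) * Polynomial.X ^ d := by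
  have h (i : Fin (n + 1)) : coneCoord z i =
      Polynomial.C ((Fin.cons 1 fun i : Fin n => z i : Fin (n + 1) → R) i) * Polynomial.X := by
    refine Fin.cases ?_ (fun i => ?_) i
    · simp [coneCoord]
    · simp [coneCoord]
  rw [coneHom, aeval_def, aeval_def, eval₂_eq', eval₂_eq', map_sum, Finset.sum_mul]
  refine Finset.sum_congr rfl fun s hs => ?_
  have hd : ∑ i, s i = d := by
    rw [← Finsupp.degree_eq_sum, Finsupp.degree_eq_weight_one]
    exact hF (mem_support_iff.1 hs)
  simp only [h, mul_pow, Finset.prod_mul_distrib, Finset.prod_pow_eq_pow_sum, hd, map_mul, map_prod,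
    map_pow]
  rw [mul_assoc]
  rfl

variable {T : PreimageArrangement (n + 1)} {ε : ℕ → K} {j : ℕ → ℕ} (hT : T.IsDescribedBy ε j)

include hT

theorem IsDescribedBy.index_lt (k : Fin (n + 1)) (hk : k ≠ 0) : j k < n + 1 :=
  (hT.lt k (Nat.one_le_iff_ne_zero.2 fun h => hk (Fin.ext h))).trans k.2

theorem IsDescribedBy.pointHom_equation {a : K} {z : ℕ → R}
    (hz : ∀ k, 1 ≤ k → k ≤ n →
      z k ^ 2 = z 0 ^ 2 + algebraMap K R (ε k) * z (j k) - algebraMap K R a) (i : Fin (n + 1)) :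
    pointHom a (n + 1) z (T.equation a i) = 0 := by
  rw [equation]
  by_cases hi : i = 0
  · subst hi
    rw [hT.image_zero, map_sub, map_add, map_pow, pointHom_X_some, pointHom_X_none, algHom_C]
    simp
  · have h1 : 1 ≤ (i : ℕ) := Nat.one_le_iff_ne_zero.2 fun h => hi (Fin.ext h)
    rw [hT.image_of_ne_zero a i ⟨j i, hT.index_lt i hi⟩ hi rfl, map_sub, map_add, map_pow, map_mul,
      pointHom_X_some, pointHom_X_some, pointHom_X_none, algHom_C, hz i h1 (by omega)]
    ring

theorem IsDescribedBy.aeval_eq_zero_of_dehomogenize_mem {a : K} {z : ℕ → R}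
    (hz : ∀ k, 1 ≤ k → k ≤ n →
      z k ^ 2 = z 0 ^ 2 + algebraMap K R (ε k) * z (j k) - algebraMap K R a)
    {F : MvPolynomial (Fin (n + 1 + 1)) K}
    (hF : dehomogenize K (n + 1) F ∈ T.affineIdeal a) :
    aeval (Fin.cons 1 fun i : Fin (n + 1) => z i) F = 0 := by
  have h : T.affineIdeal a ≤ RingHom.ker (pointHom a (n + 1) z) := by
    rw [affineIdeal_eq_span, Ideal.span_le]
    rintro _ ⟨i, rfl⟩
    exact hT.pointHom_equation hz i
  rw [← pointHom_dehomogenize a z F]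
  exact h hF

theorem IsDescribedBy.aeval_eq_zero {a : K} {z : ℕ → R}
    (hz : ∀ k, 1 ≤ k → k ≤ n →
      z k ^ 2 = z 0 ^ 2 + algebraMap K R (ε k) * z (j k) - algebraMap K R a)
    {F : MvPolynomial (Fin (n + 1 + 1)) K} (hF : F ∈ T.fiberIdeal a) :
    aeval (Fin.cons 1 fun i : Fin (n + 1) => z i) F = 0 := by
  have h : T.fiberIdeal a ≤ RingHom.ker (aeval (R := K)
      (Fin.cons 1 fun i : Fin (n + 1) => z i : Fin (n + 1 + 1) → R)) :=
    Ideal.span_le.2 fun F hF => hT.aeval_eq_zero_of_dehomogenize_mem hz hF.2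
  exact h hF

theorem IsDescribedBy.dehomogenize_towerQuadric (a : K) (k : Fin (n + 1)) (hk : k ≠ 0) :
    dehomogenize K (n + 1) (towerQuadric a ε j (n + 2) k) =
      T.equation a k - T.equation a 0 := by
  have h0 : dehomogenize K (n + 1) (varOrZero K (n + 2) 0) = 1 := by
    rw [varOrZero, dif_pos (by omega), dehomogenize, aeval_X]
    rfl
  have h1 (i : Fin (n + 1)) :
      dehomogenize K (n + 1) (varOrZero K (n + 2) (i + 1)) = X (some i) := by
    rw [varOrZero, dif_pos (by omega), dehomogenize, aeval_X]
    exact Fin.cons_succ (α := fun _ => MvPolynomial (Option (Fin (n + 1))) K) 1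
      (fun i => X (some i)) i
  have h2 := h1 ⟨j k, hT.index_lt k hk⟩
  have h3 := h1 0
  simp only [Fin.val_zero, zero_add] at h2 h3
  unfold towerQuadric
  simp only [map_add, map_sub, map_mul, map_pow]
  rw [h0, h1, h2, h3, algHom_C, algHom_C, equation, equation, hT.image_zero,
    hT.image_of_ne_zero a k ⟨j k, hT.index_lt k hk⟩ hk rfl, algebraMap_eq]
  ring

theorem IsDescribedBy.towerQuadric_mem (a : K) (k : ℕ) (hk : k ∈ Set.Icc 1 n) :
    towerQuadric a ε j (n + 2) k ∈ T.fiberIdeal a := by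
  refine Ideal.subset_span ⟨⟨2, isHomogeneous_towerQuadric _ _ _ _ _⟩, ?_⟩
  have h := hT.dehomogenize_towerQuadric a ⟨k, by have := hk.2; omega⟩ (by
    have := hk.1
    rw [Ne, Fin.ext_iff]; exact (by omega : k ≠ 0))
  rw [dehomogenize] at h
  rw [h, affineIdeal_eq_span]
  exact sub_mem (Ideal.subset_span ⟨_, rfl⟩) (Ideal.subset_span ⟨_, rfl⟩)

/-- A form in the fiber ideal's generating set vanishes at `(1, z)`, hence on the cone. Conversely,
the kernel is generated by quadrics which dehomogenize to differences of two affine equations, where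
`c` cancels. -/
theorem IsDescribedBy.fiberIdeal_eq {a : K} {z : ℕ → R} (hz : IsTower a ε j n z) :
    T.fiberIdeal a = RingHom.ker (coneHom K (n + 2) z) := by
  refine le_antisymm (Ideal.span_le.2 ?_) ?_
  · rintro F ⟨⟨d, hd⟩, hF⟩
    change coneHom K (n + 2) z F = 0
    rw [coneHom_of_isHomogeneous z hd, hT.aeval_eq_zero_of_dehomogenize_mem hz.relation hF,
      map_zero, zero_mul]
  · rw [hz.ker_eq, Ideal.span_le]
    rintro _ ⟨k, hk, rfl⟩
    exact hT.towerQuadric_mem a k hk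

end Point

/-! ### Gradients of the affine equations and of the quadrics -/

section Gradient

variable {E : Type*} [Field E] [Algebra K E]

theorem pointHom_pderiv_dehomogenize (a : K) (ζ : ℕ → E) (F : MvPolynomial (Fin (n + 1)) K)
    (o : Option (Fin n)) : pointHom a n ζ (pderiv o (dehomogenize K n F)) =
      o.elim 0 fun l => aeval (Fin.cons 1 fun i : Fin n => ζ i) (pderiv l.succ F) := by
  classical
  induction F using MvPolynomial.induction_on with
  | C c =>
    rw [algHom_C, algebraMap_eq, pderiv_C, map_zero]
    cases o <;> simp
  | add p q hp hq =>
    rw [map_add, map_add, map_add, hp, hq]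
    cases o <;> simp
  | mul_X p i hp =>
    rw [map_mul, Derivation.leibniz, map_add, smul_eq_mul, smul_eq_mul, map_mul, map_mul, hp,
      pointHom_dehomogenize, pointHom_dehomogenize]
    have hX : dehomogenize K n (X i) =
        (Fin.cons 1 (fun i => X (some i)) : Fin (n + 1) → MvPolynomial (Option (Fin n)) K) i := by
      rw [dehomogenize, aeval_X]
    rw [hX]
    refine Fin.cases ?_ (fun i => ?_) i
    · cases o <;> simp [pderiv_X]
    · cases o with
      | none => simp [pderiv_X]
      | some l =>
        simp only [Fin.cons_succ, pderiv_X, aeval_X, Option.elim_some, Derivation.leibniz, map_add,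
          map_mul, smul_eq_mul]
        congr 1
        by_cases h : i = l
        · subst h; simp
        · simp [h]

theorem IsDescribedBy.pointHom_pderiv_equation {T : PreimageArrangement (n + 1)} {ε : ℕ → K}
    {j : ℕ → ℕ} (hT : T.IsDescribedBy ε j) (a : K) (ζ : ℕ → E) (i l : Fin (n + 1)) :
    pointHom a (n + 1) ζ (pderiv (some l) (T.equation a i)) =
      (if l = 0 then 2 * ζ 0 else 0) + if i = 0 then 0 else towerGradient ε j ζ i l := by
  classical
  by_cases hi : i = 0
  · subst hi
    rw [if_pos rfl, add_zero, equation, hT.image_zero]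
    simp only [map_sub, map_add, pderiv_C, Derivation.leibniz_pow, pderiv_X]
    by_cases hl : l = 0
    · subst hl; simp [pointHom_X_some, map_ofNat]
    · simp [hl, Ne.symm hl]
  · have hk := hT.image_of_ne_zero a i ⟨j i, hT.index_lt i hi⟩ hi rfl
    rw [if_neg hi, equation, hk]
    have h0 : (l : ℕ) = 0 ↔ l = 0 := ⟨fun h => Fin.ext h, fun h => by rw [h]; rfl⟩
    have h1 : (l : ℕ) = i ↔ l = i := Fin.ext_iff.symm
    have h2 : (l : ℕ) = j i ↔ l = ⟨j i, hT.index_lt i hi⟩ :=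
      ⟨fun h => Fin.ext h, fun h => by rw [h]⟩
    simp only [map_sub, map_add, Derivation.leibniz_pow, pderiv_X, towerGradient, h0, h1, h2,
      pderiv_C_mul, Pi.single_apply, Option.some_inj, reduceCtorEq, if_false]
    simp only [eq_comm (b := l)]
    split_ifs <;> simp [pointHom_X_some, map_ofNat] <;> ring

/-- The gradient of the `k`-th quadric at a point of the curve. -/
noncomputable def coneGradient (ε : ℕ → K) (j : ℕ → ℕ) (n : ℕ) (ζ : ℕ → E) (k : Fin n) :
    Fin (n + 1 + 1) → E :=
  -- Euler's relation at a zero with `Z_0 = 1` forces the first entry.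
  Fin.cons (-∑ l : Fin (n + 1), ζ l * towerGradient ε j ζ (k + 1) l)
    fun l => towerGradient ε j ζ (k + 1) l

theorem pointHom_pderiv_none_equation (T : PreimageArrangement n) (a : K) (ζ : ℕ → E) (i : Fin n) :
    pointHom a n ζ (pderiv none (T.equation a i)) = 1 := by
  classical
  have : pderiv none (T.image a i) = 0 := by
    rw [image]
    split
    · exact pderiv_C
    · rw [← map_intCast (C (σ := Option (Fin n)) (R := K)), pderiv_C_mul]
      simp [pderiv_X]
  rw [equation, map_sub, map_add, this]
  simp [pderiv_X, Derivation.leibniz_pow]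

end Gradient

/-! ### Gradients of the fiber ideal at a geometric point -/

section GeometricPoint

variable {T : PreimageArrangement (n + 1)} {ε : ℕ → K} {j : ℕ → ℕ} (hT : T.IsDescribedBy ε j)
  {a : K} {ζ : ℕ → AlgebraicClosure K} (hζ : ∀ k, 1 ≤ k → k ≤ n →
    ζ k ^ 2 = ζ 0 ^ 2 + algebraMap K _ (ε k) * ζ (j k) - algebraMap K _ a)

include hT hζ

/-- Write `F(1, z) = ∑ c_i e_i` with the affine equations `e_i` and differentiate at the point,
where all `e_i` vanish. The derivative in `c` gives `∑ c_i = 0` there, so only the gradients of the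
differences `e_k - e_0` remain, which are those of the quadrics. Euler's relation supplies the `Z_0`
entry. -/
theorem IsDescribedBy.gradientAt_mem_span_of_isHomogeneous {d : ℕ}
    {F : MvPolynomial (Fin (n + 1 + 1)) K} (hd : F.IsHomogeneous d)
    (hF : dehomogenize K (n + 1) F ∈ T.affineIdeal a) :
    gradientAt (Fin.cons 1 fun i : Fin (n + 1) => ζ i) F ∈
      Submodule.span (AlgebraicClosure K) (Set.range (coneGradient ε j n ζ)) := by
  have hF0 := hT.aeval_eq_zero_of_dehomogenize_mem hζ hF
  rw [affineIdeal_eq_span, Ideal.mem_span_range_iff_exists_fun] at hF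
  obtain ⟨c, hc⟩ := hF
  set A : Fin (n + 1) → AlgebraicClosure K := fun i => pointHom a (n + 1) ζ (c i)
  have hder (o : Option (Fin (n + 1))) :
      pointHom a (n + 1) ζ (pderiv o (dehomogenize K (n + 1) F)) =
        ∑ i, A i * pointHom a (n + 1) ζ (pderiv o (T.equation a i)) := by
    rw [← hc, map_sum, map_sum]
    refine Finset.sum_congr rfl fun i _ => ?_
    rw [Derivation.leibniz, map_add, smul_eq_mul, smul_eq_mul, map_mul, map_mul,
      hT.pointHom_equation hζ, zero_mul, add_zero]
  have hA : ∑ i, A i = 0 := by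
    have h := hder none
    rw [pointHom_pderiv_dehomogenize] at h
    simpa [pointHom_pderiv_none_equation] using h.symm
  have hl (l : Fin (n + 1)) : gradientAt (Fin.cons 1 fun i : Fin (n + 1) => ζ i) F l.succ =
      ∑ k : Fin n, A k.succ * towerGradient ε j ζ (k + 1) l := by
    have h := hder (some l)
    rw [pointHom_pderiv_dehomogenize] at h
    change aeval _ (pderiv l.succ F) = _
    refine h.trans ?_
    simp only [hT.pointHom_pderiv_equation, mul_add, Finset.sum_add_distrib]
    rw [← Finset.sum_mul, hA, zero_mul, zero_add, Fin.sum_univ_succ, if_pos rfl, mul_zero, zero_add]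
    refine Finset.sum_congr rfl fun k _ => ?_
    rw [if_neg (Fin.succ_ne_zero k), Fin.val_succ]
  have h0 : gradientAt (Fin.cons 1 fun i : Fin (n + 1) => ζ i) F 0 =
      -∑ l : Fin (n + 1), ζ l *
        gradientAt (Fin.cons 1 fun i : Fin (n + 1) => ζ i) F l.succ := by
    have h := congrArg (aeval (Fin.cons 1 fun i : Fin (n + 1) => ζ i :
      Fin (n + 1 + 1) → AlgebraicClosure K)) hd.sum_X_mul_pderiv
    rw [map_nsmul, hF0, smul_zero, map_sum, Fin.sum_univ_succ] at h
    simp only [map_mul, aeval_X, Fin.cons_zero, Fin.cons_succ, one_mul] at h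
    exact eq_neg_of_add_eq_zero_left h
  have : gradientAt (Fin.cons 1 fun i : Fin (n + 1) => ζ i) F =
      ∑ k : Fin n, A k.succ • coneGradient ε j n ζ k := by
    ext i
    rw [Finset.sum_apply]
    refine Fin.cases ?_ (fun l => ?_) i
    · simp only [h0, hl, Pi.smul_apply, coneGradient, Fin.cons_zero, smul_eq_mul, mul_neg,
        Finset.sum_neg_distrib, Finset.mul_sum]
      rw [Finset.sum_comm]
      simp only [mul_left_comm]
    · simp only [hl, Pi.smul_apply, coneGradient, Fin.cons_succ, smul_eq_mul]
  rw [this]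
  exact Submodule.sum_mem _ fun k _ => Submodule.smul_mem _ _ (Submodule.subset_span ⟨k, rfl⟩)

theorem IsDescribedBy.gradientAt_mem_span {F : MvPolynomial (Fin (n + 1 + 1)) K}
    (hF : F ∈ T.fiberIdeal a) :
    gradientAt (Fin.cons 1 fun i : Fin (n + 1) => ζ i) F ∈
      Submodule.span (AlgebraicClosure K) (Set.range (coneGradient ε j n ζ)) := by
  induction hF using Submodule.span_induction with
  | mem F hF => exact hT.gradientAt_mem_span_of_isHomogeneous hζ hF.1.choose_spec hF.2
  | zero =>
    convert Submodule.zero_mem _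
    ext i
    simp [gradientAt]
  | add F G _ _ hF hG =>
    convert Submodule.add_mem _ hF hG using 1
    ext i
    simp [gradientAt]
  | smul c F hF h =>
    convert Submodule.smul_mem _
      (aeval (Fin.cons 1 fun i : Fin (n + 1) => ζ i : Fin (n + 1 + 1) → AlgebraicClosure K) c) h
        using 1
    ext i
    have := hT.aeval_eq_zero hζ hF
    simp [gradientAt, Derivation.leibniz, this]

omit hζ in
-- The gradients of the whole ideal span a space of dimension `n` inside the span of the `n` vectors
-- `coneGradient`, which are therefore independent. A relation among the affine gradients extends to
-- these, since the `Z_0` entries depend linearly on the others. Only points with `Z_0 = 1` are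
-- needed.
theorem IsDescribedBy.hasIndependentGradients
    (hns : IsNonsingularProjectiveCurve (T.fiberIdeal a)) :
    HasIndependentGradients (AlgebraicClosure K) a ε j n := by
  intro ζ hζ μ hμ
  have h := hns (Fin.cons 1 fun i : Fin (n + 1) => ζ i)
    (fun h => one_ne_zero (α := AlgebraicClosure K) (congrFun h 0))
    fun F hF => hT.aeval_eq_zero hζ hF
  have hle : Submodule.span (AlgebraicClosure K)
      (gradientAt (Fin.cons 1 fun i : Fin (n + 1) => ζ i) '' (T.fiberIdeal a : Set _)) ≤
      Submodule.span (AlgebraicClosure K) (Set.range (coneGradient ε j n ζ)) := by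
    rw [Submodule.span_le]
    rintro _ ⟨F, hF, rfl⟩
    exact hT.gradientAt_mem_span hζ hF
  have hli : LinearIndependent (AlgebraicClosure K) (coneGradient ε j n ζ) := by
    rw [linearIndependent_iff_card_le_finrank_span, Fintype.card_fin]
    have := Submodule.finrank_mono hle
    rw [Set.finrank]
    omega
  intro k hk
  rw [Finset.mem_Icc] at hk
  have hsum : ∑ k : Fin n, μ (k + 1) • coneGradient ε j n ζ k = 0 := by
    have hμ' (l : ℕ) : ∑ k : Fin n, μ (k + 1) * towerGradient ε j ζ (k + 1) l = 0 := by
      have hIcc : Finset.Icc 1 n = Finset.Ico (0 + 1) (n + 1) := by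
        ext k
        simp only [Finset.mem_Icc, Finset.mem_Ico]
        omega
      rw [← hμ l, hIcc, ← Finset.sum_Ico_add' (fun k => μ k * towerGradient ε j ζ k l),
        ← Finset.range_eq_Ico, Finset.sum_range]
    ext i
    rw [Finset.sum_apply]
    refine Fin.cases ?_ (fun l => ?_) i
    · simp only [Pi.smul_apply, coneGradient, Fin.cons_zero, smul_eq_mul, mul_neg,
        Finset.sum_neg_distrib, Finset.mul_sum]
      rw [Finset.sum_comm]
      simp only [mul_left_comm (μ _)]
      simp [← Finset.mul_sum, hμ']
    · simpa [coneGradient] using hμ' l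
  have := Fintype.linearIndependent_iff.1 hli (fun k => μ (k + 1)) hsum ⟨k - 1, by omega⟩
  simpa [Nat.sub_add_cancel hk.1] using this

end GeometricPoint

end PreimageArrangement

/-! ### The function field of the projective closure -/

section FunctionField

open MvPolynomial

variable {K R : Type*} [Field K] [CommRing R] [IsDomain R] [Algebra K R]

/-- The function field of the projective closure of a curve is the fraction field of the
coordinate ring of the curve. -/
theorem nonempty_projectiveFunctionField_algEquiv {m : ℕ} {z : ℕ → R}
    (hz : Algebra.adjoin K (z '' Set.Iio m) = ⊤) (I : Ideal (MvPolynomial (Fin (m + 1)) K))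
    [I.IsPrime] (hI : I = RingHom.ker (coneHom K (m + 1) z))
    (hhom : ∀ (d : ℕ) (F : MvPolynomial (Fin (m + 1)) K), F.IsHomogeneous d →
      coneHom K (m + 1) z F =
        Polynomial.C (aeval (Fin.cons 1 fun i : Fin m => z i) F) * Polynomial.X ^ d) :
    Nonempty (projectiveFunctionField I ≃ₐ[K] FractionRing R) := by
  let Q := MvPolynomial (Fin (m + 1)) K ⧸ I
  let G := FractionRing (Polynomial R)
  let q : Q →ₐ[K] Polynomial R := Ideal.Quotient.liftₐ I (coneHom K (m + 1) z)
    fun F hF => by rw [hI] at hF; exact hF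
  have hq : Function.Injective q := by
    rw [injective_iff_map_eq_zero]
    intro x hx
    obtain ⟨F, rfl⟩ := Ideal.Quotient.mk_surjective x
    rw [Ideal.Quotient.eq_zero_iff_mem, hI]
    exact hx
  let g : Q →ₐ[K] G := (IsScalarTower.toAlgHom K (Polynomial R) G).comp q
  have hg : Function.Injective g := (IsFractionRing.injective (Polynomial R) G).comp hq
  let θ : FractionRing Q →ₐ[K] G := IsFractionRing.liftAlgHom (g := g) hg
  have hθ (F : MvPolynomial (Fin (m + 1)) K) :
      θ (algebraMap Q (FractionRing Q) (Ideal.Quotient.mk I F)) =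
        algebraMap (Polynomial R) G (coneHom K (m + 1) z F) :=
    IsFractionRing.lift_algebraMap (g := g.toRingHom) hg _
  let c : R →ₐ[K] G := (IsScalarTower.toAlgHom K (Polynomial R) G).comp Polynomial.CAlgHom
  have hc : Function.Injective c :=
    (IsFractionRing.injective (Polynomial R) G).comp Polynomial.C_injective
  let ι : FractionRing R →ₐ[K] G := IsFractionRing.liftAlgHom (g := c) hc
  have hι (r : R) : ι (algebraMap R (FractionRing R) r) =
      algebraMap (Polynomial R) G (Polynomial.C r) :=
    IsFractionRing.lift_algebraMap (g := c.toRingHom) hc _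
  have hX : algebraMap (Polynomial R) G Polynomial.X ≠ 0 := by
    rw [Ne, FaithfulSMul.algebraMap_eq_zero_iff]
    exact Polynomial.X_ne_zero
  -- Both fields are compared inside `Frac R[t]`: a quotient of forms of degree `d` loses its factor
  -- `t^d`, and `z_l` is the image of `Z_{l+1} / Z_0`.
  have hrange : (projectiveFunctionField I).map θ = ι.fieldRange := by
    rw [projectiveFunctionField, IntermediateField.adjoin_map]
    refine le_antisymm (IntermediateField.adjoin_le_iff.2 ?_) ?_
    · rintro _ ⟨_, ⟨d, f, g, hf, hg, hgI, rfl⟩, rfl⟩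
      refine ⟨algebraMap R _ (aeval (Fin.cons 1 fun i : Fin m => z i) f) /
        algebraMap R _ (aeval (Fin.cons 1 fun i : Fin m => z i) g), ?_⟩
      change ι _ = θ _
      rw [map_div₀, map_div₀, hθ, hθ, hι, hι, hhom d f hf, hhom d g hg, map_mul, map_mul,
        map_pow, mul_div_mul_right _ _ (pow_ne_zero d hX)]
    · set S := IntermediateField.adjoin K (θ '' {x | ∃ (d : ℕ)
        (f g : MvPolynomial (Fin (m + 1)) K), f.IsHomogeneous d ∧ g.IsHomogeneous d ∧ g ∉ I ∧
        x = algebraMap _ (FractionRing (MvPolynomial (Fin (m + 1)) K ⧸ I))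
          (Ideal.Quotient.mk I f) /
        algebraMap _ (FractionRing (MvPolynomial (Fin (m + 1)) K ⧸ I)) (Ideal.Quotient.mk I g)})
      have hS (r : R) : ι (algebraMap R (FractionRing R) r) ∈ S := by
        have hr : r ∈ Algebra.adjoin K (z '' Set.Iio m) := by rw [hz]; exact Algebra.mem_top
        induction hr using Algebra.adjoin_induction with
        | mem r hr =>
          obtain ⟨l, hl, rfl⟩ := hr
          refine IntermediateField.subset_adjoin _ _
            ⟨_, ⟨1, X (⟨l, hl⟩ : Fin m).succ, X 0, isHomogeneous_X _ _, isHomogeneous_X _ _, ?_,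
              rfl⟩, ?_⟩
          · rw [hI]
            intro h
            exact Polynomial.X_ne_zero (R := R)
              ((aeval_X (R := K) (fun i : Fin (m + 1) => coneCoord z i) 0).symm.trans h)
          · rw [map_div₀, hθ, hθ, hι]
            simp only [coneHom, aeval_X, Fin.val_succ, Fin.val_zero, coneCoord, map_mul]
            rw [mul_div_cancel_right₀ _ hX]
        | algebraMap k =>
          rw [← IsScalarTower.algebraMap_apply, AlgHom.commutes]
          exact S.algebraMap_mem k
        | add r s _ _ hr hs => rw [map_add, map_add]; exact add_mem hr hs
        | mul r s _ _ hr hs => rw [map_mul, map_mul]; exact mul_mem hr hs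
      rintro _ ⟨x, rfl⟩
      obtain ⟨r, s, _, rfl⟩ := IsFractionRing.div_surjective (A := R) x
      change ι _ ∈ S
      rw [map_div₀]
      exact div_mem (hS r) (hS s)
  exact ⟨((projectiveFunctionField I).equivMap θ).trans
    ((IntermediateField.equivOfEq hrange).trans (AlgEquiv.ofInjectiveField ι).symm)⟩

end FunctionField

/-! ### Genus, complete intersection and the conclusion -/

/-- Regular differentials on a model of a function field. -/
theorem IsModel.finite_and_finrank_of_algEquiv {K L : Type u} [Field K] [CharZero K] [Field L]
    [Algebra K L] {V : ValuationSubring L} {s : L} {δ : Derivation K L L}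
    {hV : IsPlaceAtInfinity V s δ} {R : Type u} [CommRing R] [IsDomain R] [Algebra K R] {x P : R}
    {D : Derivation K R R} {m : ℕ} (hM : IsModel hV x P D m) {F : Type u} [Field F] [Algebra K F]
    (e : F ≃ₐ[K] FractionRing R) :
    Module.Finite K (regularDifferentials K F) ∧
      Module.finrank K (regularDifferentials K F) = poleDim m (m - 2) := by
  let _ : Algebra R F := ((e.symm : FractionRing R →+* F).comp
    (algebraMap R (FractionRing R))).toAlgebra
  have : IsScalarTower K R F := IsScalarTower.of_algebraMap_eq fun k => by
    change _ = e.symm (algebraMap R (FractionRing R) (algebraMap K R k))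
    rw [← IsScalarTower.algebraMap_apply, AlgEquiv.commutes]
  let e' : FractionRing R ≃ₐ[R] F := AlgEquiv.ofRingEquiv (f := e.symm.toRingEquiv) fun r => rfl
  have : IsFractionRing R F := IsLocalization.isLocalization_of_algEquiv _ e'
  exact hM.finite_and_finrank_regularDifferentials F

/-- The upper bound on the height is Krull's theorem for a prime generated by `m` elements; the
lower bound is the chain of primes recorded in `le_height`. -/
theorem IsTower.isCompleteIntersectionOfQuadrics {K R : Type*} [Field K] [CommRing R]
    [IsDomain R] [Algebra K R] {a : K} {ε : ℕ → K} {j : ℕ → ℕ} {m : ℕ} {z : ℕ → R}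
    (hz : IsTower a ε j m z) :
    IsCompleteIntersectionOfQuadrics (m := m + 1) (RingHom.ker (coneHom K (m + 2) z)) m := by
  have hrange : towerQuadric a ε j (m + 2) '' Set.Icc 1 m =
      Set.range fun i : Fin m => towerQuadric a ε j (m + 2) (i + 1) := by
    ext F
    constructor
    · rintro ⟨k, ⟨h1, h2⟩, rfl⟩
      exact ⟨⟨k - 1, by omega⟩, by simp only [Nat.sub_add_cancel h1]⟩
    · rintro ⟨i, rfl⟩
      exact ⟨i + 1, ⟨by omega, by omega⟩, rfl⟩
  have hspan := hz.ker_eq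
  rw [hrange] at hspan
  refine ⟨_, fun i => isHomogeneous_towerQuadric a ε j (m + 2) (i + 1), hspan, le_antisymm ?_ ?_⟩
  · have hp : (RingHom.ker (coneHom K (m + 2) z)).IsPrime := RingHom.ker_isPrime _
    refine (Ideal.height_le_card_of_mem_minimalPrimes_span (Set.finite_range _)
      (p := RingHom.ker (coneHom K (m + 2) z)) ?_).trans (Nat.cast_le.2 (?_ :
        (Set.range fun i : Fin m => towerQuadric a ε j (m + 2) (i + 1)).ncard ≤ m))
    · rw [← hspan, Ideal.minimalPrimes_eq_subsingleton_self]
      rfl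
    · rw [← Set.image_univ]
      exact (Set.ncard_image_le Set.finite_univ).trans (by simp)
  · have h : RingHom.ker (cylinderHom K m (m + 2) z) = RingHom.ker (coneHom K (m + 2) z) :=
      Ideal.ext fun F => cylinderHom_eq_zero_iff z F
    exact h ▸ hz.le_height (m + 2) le_rfl

theorem theorem4p1 {K : Type*} [Field K] [CharZero K] {N : ℕ} (hN : 1 ≤ N)
    (T : PreimageArrangement N) (a : K)
    (hns : IsNonsingularProjectiveCurve (T.fiberIdeal a)) :
    IsCompleteIntersectionOfQuadrics (T.fiberIdeal a) (N - 1) ∧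
      ∃ _ : (T.fiberIdeal a).IsPrime,
        Module.Finite K (regularDifferentials K (projectiveFunctionField (T.fiberIdeal a))) ∧
        (geometricGenus (T.fiberIdeal a) : ℚ) = ((N : ℚ) - 3) * 2 ^ ((N : ℤ) - 2) + 1 ∧
        (8 ≤ 2 * N → 1 < geometricGenus (T.fiberIdeal a)) := by
  obtain ⟨n, rfl⟩ : ∃ n, N = n + 1 := ⟨N - 1, by omega⟩
  obtain ⟨ε, j, hT⟩ := T.exists_isDescribedBy K
  obtain ⟨L, _, _, V, s, δ, hV⟩ := exists_isPlaceAtInfinity K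
  obtain ⟨R, _, _, z, D, hM, hz, -⟩ :=
    exists_isModel_and_isTower hV hT.lt (hT.hasIndependentGradients hns) n le_rfl
  have := hM.isDedekindDomain
  have hI := hT.fiberIdeal_eq hz
  have hprime : (T.fiberIdeal a).IsPrime := hI ▸ RingHom.ker_isPrime _
  obtain ⟨e⟩ := nonempty_projectiveFunctionField_algEquiv (m := n + 1) (z := z)
    (by rw [← hz.adjoin_eq_top]; congr 2; ext; simp) (T.fiberIdeal a) hI
    fun d F hF => PreimageArrangement.coneHom_of_isHomogeneous z hF
  obtain ⟨hfin, hrank⟩ := hM.finite_and_finrank_of_algEquiv e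
  have hgenus : (geometricGenus (T.fiberIdeal a) : ℚ) =
      ((n : ℚ) - 2) * 2 ^ ((n : ℤ) - 1) + 1 := by
    rw [geometricGenus, hrank, poleDim_sub_two]
  refine ⟨?_, hprime, hfin, ?_, fun hn => ?_⟩
  · rw [hI]
    exact hz.isCompleteIntersectionOfQuadrics
  · rw [hgenus]
    push_cast
    rw [show (n : ℤ) + 1 - 2 = n - 1 by ring]
    ring
  · have h3 : (3 : ℚ) ≤ n := by exact_mod_cast (by omega : 3 ≤ n)
    have h2 : (0 : ℚ) < 2 ^ ((n : ℤ) - 1) := by positivity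
    -- For `n = N - 1 ≥ 3` the term `(n - 2) 2^(n - 1)` is positive.
    have : (1 : ℚ) < geometricGenus (T.fiberIdeal a) := by
      rw [hgenus]
      nlinarith
    exact_mod_cast this
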